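/- Let $q$ be a complex number with $0<|q|<1$. Write $$(a;q)_n=\prod_{j=0}^{n-1}(1-aq^j),\qquad (a_1,a_2;q)_n=(a_1;q)_n(a_2;q)_n,\qquad \psi(q)=\sum_{n=0}^{\infty}q^{n(n+1)/2}.$$ Then each of the four series below converges absolutely, and $$\begin{aligned} 2q\,\psi(q^2)\,\psi(q^6)={}&\sum_{n=1}^{\infty}\frac{1+q^{12n-1}}{1+1/q}\,\frac{(-1/q,-1/q;q^6)_n\,(q^6;q^6)_{2n-1}\,(-q)^{5n}}{(q^6,q^6;q^6)_n\,(q^4;q^6)_{2n}}\\ &-\sum_{n=1}^{\infty}\frac{1-q^{12n-1}}{1-1/q}\,\frac{(1/q,1/q;q^6)_n\,(q^6;q^6)_{2n-1}\,q^{5n}}{(q^6,q^6;q^6)_n\,(q^4;q^6)_{2n}}\\ &+\sum_{n=1}^{\infty}\frac{1-q^{12n-5}}{1-1/q^5}\,\frac{(1/q^5,1/q^5;q^6)_n\,(q^6;q^6)_{2n-1}\,q^{n}}{(q^6,q^6;q^6)_n\,(1/q^4;q^6)_{2n}}\\ &-\sum_{n=1}^{\infty}\frac{1+q^{12n-5}}{1+1/q^5}\,\frac{(-1/q^5,-1/q^5;q^6)_n\,(q^6;q^6)_{2n-1}\,(-q)^{n}}{(q^6,q^6;q^6)_n\,(1/q^4;q^6)_{2n}}.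 \end{aligned}$$ -/

import Mathlib

/-- The finite `q`-shifted factorial `(a; q)_n = (1 - a)(1 - a q) ⋯ (1 - a q^(n-1))`. -/
noncomputable def qPoch (a q : ℂ) (n : ℕ) : ℂ :=
  ∏ j ∈ Finset.range n, (1 - a * q ^ j)

/-- The theta function `ψ(q) = ∑_{n ≥ 0} q^(n(n+1)/2)`, absolutely convergent for `|q| < 1`
(the exponent `n(n+1)/2` is an exact division). -/
noncomputable def ramanujanPsi (q : ℂ) : ℂ :=
  ∑' n : ℕ, q ^ (n * (n + 1) / 2)

open Filter Topology

/-! Put Q = q⁶ and let F(b) be the sum over n ≥ 1 of `vwpTerm b Q n`. The four series are F(b) for b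
= -1/q, 1/q, 1/q⁵, -1/q⁵, so the right-hand side is the odd part of F at 1/q⁵ minus the odd part at
1/q (each odd part taken as F(b) - F(-b)). F is a Lambert-type series. A rational certificate
(`vwpTerm_telescope`) makes F(b) - 2F(bQ) + F(bQ²) telescope in n, and the boundary term is D(b) -
D(bQ) with D = `vwpDiff` (`vwpAnti_one`). Hence F(b) - F(bQ) - D(b) is invariant under b ↦ bQ; it
tends to 0 along bQᵐ, so it vanishes, and F(b) = ∑ D(bQᵐ) (`tendsto_sum_vwpDiff`). In D(b) - D(-b)
only 2bQ/(1 - b²Q²) survives. It remains to show that ∑ (q^(6m+1)/(1 - q^(12m+2)) - q^(6m+5)/(1 -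
q^(12m+10))) equals q ψ(q²) ψ(q⁶) (`tendsto_lambert_psi_mul_psi`). This Lambert series is a
very-well-poised `₆φ₅` in base q¹². Its sum is an infinite product (`sixPhi_sum`, again by
telescoping), and Gauss' product for ψ (`tendsto_psiProd`) identifies that product. -/

/-! ### Finite q-shifted factorials and uniform bounds for them. -/

theorem qPoch_zero (a q : ℂ) : qPoch a q 0 = 1 := by simp [qPoch]

theorem qPoch_one (a q : ℂ) : qPoch a q 1 = 1 - a := by simp [qPoch]

theorem qPoch_succ (a q : ℂ) (n : ℕ) : qPoch a q (n + 1) = qPoch a q n * (1 - a * q ^ n) := by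
  simp [qPoch, Finset.prod_range_succ]

theorem qPoch_add (a q : ℂ) (m n : ℕ) :
    qPoch a q (m + n) = qPoch a q m * qPoch (a * q ^ m) q n := by
  simp only [qPoch, Finset.prod_range_add]
  congr 1
  refine Finset.prod_congr rfl fun j _ => ?_
  rw [pow_add]; ring

theorem qPoch_ne_zero {a q : ℂ} (h : ∀ j : ℕ, 1 - a * q ^ j ≠ 0) (n : ℕ) : qPoch a q n ≠ 0 :=
  Finset.prod_ne_zero_iff.2 fun j _ => h j

theorem one_sub_mul_qPoch_shift (a q : ℂ) (n : ℕ) :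
    (1 - a) * qPoch (a * q) q n = qPoch a q n * (1 - a * q ^ n) := by
  rw [← qPoch_succ, add_comm n 1, qPoch_add, qPoch_one, pow_one]

theorem one_sub_ne_zero_of_norm_lt_one {x : ℂ} (h : ‖x‖ < 1) : 1 - x ≠ 0 := by
  intro h0
  rw [← sub_eq_zero.1 h0] at h
  simp at h

theorem one_sub_mul_pow_ne_zero {a q : ℂ} (ha : ‖a‖ < 1) (hq : ‖q‖ < 1) (j : ℕ) :
    1 - a * q ^ j ≠ 0 := by
  apply one_sub_ne_zero_of_norm_lt_one
  rw [norm_mul, norm_pow]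
  exact lt_of_le_of_lt (mul_le_of_le_one_right (norm_nonneg _)
    (pow_le_one₀ (norm_nonneg _) hq.le)) ha

/-- Finite products of `1 + u j` are bounded when `u` is summable. -/
theorem norm_prod_one_add_le {u : ℕ → ℂ} {v : ℕ → ℝ} (hv : Summable v)
    (huv : ∀ j, ‖u j‖ ≤ v j) (n : ℕ) :
    ‖∏ j ∈ Finset.range n, (1 + u j)‖ ≤ Real.exp (∑' j, v j) := by
  rw [norm_prod]
  calc ∏ j ∈ Finset.range n, ‖1 + u j‖ ≤ ∏ j ∈ Finset.range n, Real.exp (v j) := by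
        refine Finset.prod_le_prod (fun _ _ => norm_nonneg _) fun j _ => ?_
        calc ‖1 + u j‖ ≤ ‖(1 : ℂ)‖ + ‖u j‖ := norm_add_le _ _
          _ ≤ v j + 1 := by rw [norm_one]; linarith [huv j]
          _ ≤ Real.exp (v j) := Real.add_one_le_exp _
    _ = Real.exp (∑ j ∈ Finset.range n, v j) := (Real.exp_sum _ _).symm
    _ ≤ _ := Real.exp_le_exp.2
        (hv.sum_le_tsum _ fun j _ => (norm_nonneg _).trans (huv j))

theorem exists_norm_qPoch_le {q : ℂ} (hq : ‖q‖ < 1) (r : ℝ) :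
    ∃ C, 0 < C ∧ ∀ a : ℂ, ‖a‖ ≤ r → ∀ n, ‖qPoch a q n‖ ≤ C := by
  refine ⟨Real.exp (∑' j, r * ‖q‖ ^ j), Real.exp_pos _, fun a ha n => ?_⟩
  have := norm_prod_one_add_le (u := fun j => -(a * q ^ j)) (v := fun j => r * ‖q‖ ^ j)
    ((summable_geometric_of_lt_one (norm_nonneg _) hq).mul_left r) (fun j => by
      rw [norm_neg, norm_mul, norm_pow]
      gcongr) n
  simpa [qPoch, sub_eq_add_neg] using this

/-- Each inverse factor is 1 + a q^j / (1 - a q^j). The inverses converge to 1, hence are bounded,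
so the perturbations are dominated by a geometric series. -/
theorem exists_norm_inv_qPoch_le {a q : ℂ} (hq : ‖q‖ < 1) (h : ∀ j : ℕ, 1 - a * q ^ j ≠ 0) :
    ∃ C, 0 < C ∧ ∀ n, ‖(qPoch a q n)⁻¹‖ ≤ C := by
  have ht : Tendsto (fun j : ℕ => (1 - a * q ^ j)⁻¹) atTop (𝓝 1) := by
    have h1 : Tendsto (fun j : ℕ => 1 - a * q ^ j) atTop (𝓝 (1 - a * 0)) :=
      ((tendsto_pow_atTop_nhds_zero_of_norm_lt_one hq).const_mul a).const_sub 1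
    simpa using h1.inv₀ (by simp)
  obtain ⟨B, hB⟩ := (Metric.isBounded_range_of_tendsto _ ht).exists_norm_le
  have hB' : ∀ j : ℕ, ‖(1 - a * q ^ j)⁻¹‖ ≤ B := fun j => hB _ ⟨j, rfl⟩
  refine ⟨Real.exp (∑' j, (‖a‖ * B) * ‖q‖ ^ j), Real.exp_pos _, fun n => ?_⟩
  have := norm_prod_one_add_le (u := fun j => (a * q ^ j) * (1 - a * q ^ j)⁻¹)
    (v := fun j => (‖a‖ * B) * ‖q‖ ^ j)
    ((summable_geometric_of_lt_one (norm_nonneg _) hq).mul_left _) (fun j => by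
      rw [norm_mul, norm_mul, norm_pow]
      have := mul_le_mul_of_nonneg_left (hB' j)
        (mul_nonneg (norm_nonneg a) (pow_nonneg (norm_nonneg q) j))
      linarith) n
  convert this using 2
  rw [qPoch, ← Finset.prod_inv_distrib]
  refine Finset.prod_congr rfl fun j _ => ?_
  have := h j
  field_simp
  ring

/-- Uniformity in the shift `m` is the point: it controls the series along b q^m as m → ∞. It comes
from 1/(a q^m; q)_n = (a; q)_m / (a; q)_(m+n). -/
theorem exists_norm_inv_qPoch_shift_le {a q : ℂ} (hq : ‖q‖ < 1)
    (h : ∀ j : ℕ, 1 - a * q ^ j ≠ 0) :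
    ∃ C, 0 < C ∧ ∀ m n, ‖(qPoch (a * q ^ m) q n)⁻¹‖ ≤ C := by
  obtain ⟨C, hC, h1⟩ := exists_norm_qPoch_le hq ‖a‖
  obtain ⟨D, hD, h2⟩ := exists_norm_inv_qPoch_le hq h
  refine ⟨C * D, mul_pos hC hD, fun m n => ?_⟩
  have : (qPoch (a * q ^ m) q n)⁻¹ = qPoch a q m * (qPoch a q (m + n))⁻¹ := by
    have := qPoch_ne_zero h m
    rw [qPoch_add, mul_inv]
    field_simp
  rw [this, norm_mul]
  exact mul_le_mul (h1 a le_rfl m) (h2 _) (norm_nonneg _) hC.le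

theorem norm_mul_pow_le {a q : ℂ} (hq : ‖q‖ < 1) (m : ℕ) : ‖a * q ^ m‖ ≤ ‖a‖ := by
  rw [norm_mul, norm_pow]
  exact mul_le_of_le_one_right (norm_nonneg _) (pow_le_one₀ (norm_nonneg _) hq.le)

/-! ### The very-well-poised series: telescoping its second q-difference. -/

/-- Summand of the very-well-poised series with parameters `b, b` and argument `b q`. -/
noncomputable def vwpTerm (b q : ℂ) (n : ℕ) : ℂ :=
  (1 - b * q ^ (2 * n)) / (1 - b) *
    (qPoch b q n * qPoch b q n * qPoch q q (2 * n - 1) * (b * q) ^ n /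
      (qPoch q q n * qPoch q q n * qPoch (q * b ^ 2) q (2 * n)))

/-- Common factor of three consecutive `q`-shifts of `vwpTerm`. -/
noncomputable def vwpKernel (b q : ℂ) (n : ℕ) : ℂ :=
  qPoch b q n ^ 2 * qPoch q q (2 * n - 1) * (b * q) ^ n /
    (qPoch q q n ^ 2 * qPoch (q * b ^ 2) q (2 * n + 4))

/-- Polynomial part of the telescoping certificate for `vwpTerm`. -/
noncomputable def vwpPoly (b q x : ℂ) : ℂ :=
  ((1 - b) - 2 * b * (1 - q * b ^ 2) * x * (1 + b ^ 3 * q ^ 3 * x ^ 2) +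
    (b ^ 2 + b ^ 3 * (q + q ^ 2 + q ^ 3) - b ^ 4 * (q + q ^ 2 + q ^ 3) - b ^ 5 * q ^ 4) * x ^ 2 +
    (1 - b) * b ^ 6 * q ^ 4 * x ^ 4) / ((1 - b) ^ 2 * (1 - b * q))

/-- Antidifference of the second `q`-difference of `vwpTerm`. -/
noncomputable def vwpAnti (b q : ℂ) (n : ℕ) : ℂ :=
  (1 - q ^ n) ^ 2 * (1 - q ^ 3 * b ^ 2 * (q ^ n) ^ 2) * (1 - q ^ 4 * b ^ 2 * (q ^ n) ^ 2) *
    vwpPoly b q (q ^ n) * vwpKernel b q n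

/-- This is the telescoping relation divided by `vwpKernel`, with x in the role of q^n. The shift n
↦ n + 1 becomes x ↦ q x, so only a rational-function identity is left. -/
theorem vwpPoly_certificate {b q : ℂ} (x : ℂ) (h0 : 1 - b ≠ 0) (h1 : 1 - b * q ≠ 0)
    (h2 : 1 - b * q ^ 2 ≠ 0) :
    (1 - b * x ^ 2) / (1 - b) * ((1 - q * b ^ 2 * x ^ 2) * (1 - q ^ 2 * b ^ 2 * x ^ 2) *
        (1 - q ^ 3 * b ^ 2 * x ^ 2) * (1 - q ^ 4 * b ^ 2 * x ^ 2)) -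
      2 * ((1 - b * q * x ^ 2) / (1 - b * q) * ((1 - b * x) / (1 - b)) ^ 2 * x *
        ((1 - q * b ^ 2) * (1 - q ^ 2 * b ^ 2) *
          (1 - q ^ 3 * b ^ 2 * x ^ 2) * (1 - q ^ 4 * b ^ 2 * x ^ 2))) +
      (1 - b * q ^ 2 * x ^ 2) / (1 - b * q ^ 2) *
        ((1 - b * x) * (1 - b * q * x) / ((1 - b) * (1 - b * q))) ^ 2 * x ^ 2 *
        ((1 - q * b ^ 2) * (1 - q ^ 2 * b ^ 2) * (1 - q ^ 3 * b ^ 2) * (1 - q ^ 4 * b ^ 2)) =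
    (1 - x) ^ 2 * (1 - q ^ 3 * b ^ 2 * x ^ 2) * (1 - q ^ 4 * b ^ 2 * x ^ 2) * vwpPoly b q x -
      (1 - b * x) ^ 2 * (1 - x ^ 2) * (1 - q * x ^ 2) * (b * q) * vwpPoly b q (q * x) := by
  unfold vwpPoly
  field_simp
  ring

set_option maxHeartbeats 1000000 in
theorem vwpTerm_telescope {b q : ℂ} (hq : ‖q‖ < 1) (hb : ∀ j : ℕ, 1 - b * q ^ j ≠ 0)
    (hb2 : ∀ j : ℕ, 1 - q * b ^ 2 * q ^ j ≠ 0) {n : ℕ} (hn : 1 ≤ n) :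
    vwpTerm b q n - 2 * vwpTerm (b * q) q n + vwpTerm (b * q ^ 2) q n =
      vwpAnti b q n - vwpAnti b q (n + 1) := by
  have h0 : 1 - b ≠ 0 := by simpa using hb 0
  have h1 : 1 - b * q ≠ 0 := by simpa using hb 1
  have h2 : 1 - b * q ^ 2 ≠ 0 := hb 2
  have hE : qPoch q q n ≠ 0 := qPoch_ne_zero (one_sub_mul_pow_ne_zero hq hq) n
  have hD : qPoch (q * b ^ 2) q (2 * n) ≠ 0 := qPoch_ne_zero hb2 _
  have c1 : 1 - q * b ^ 2 ≠ 0 := by simpa using hb2 0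
  have c2 : 1 - q ^ 2 * b ^ 2 ≠ 0 := by convert hb2 1 using 1; ring
  have c3 : 1 - q ^ 3 * b ^ 2 ≠ 0 := by convert hb2 2 using 1; ring
  have c4 : 1 - q ^ 4 * b ^ 2 ≠ 0 := by convert hb2 3 using 1; ring
  have d1 : 1 - q * b ^ 2 * (q ^ n) ^ 2 ≠ 0 := by convert hb2 (2 * n) using 1; ring
  have d2 : 1 - q ^ 2 * b ^ 2 * (q ^ n) ^ 2 ≠ 0 := by convert hb2 (2 * n + 1) using 1; ring
  have d3 : 1 - q ^ 3 * b ^ 2 * (q ^ n) ^ 2 ≠ 0 := by convert hb2 (2 * n + 2) using 1; ring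
  have d4 : 1 - q ^ 4 * b ^ 2 * (q ^ n) ^ 2 ≠ 0 := by convert hb2 (2 * n + 3) using 1; ring
  have d5 : 1 - q ^ 5 * b ^ 2 * (q ^ n) ^ 2 ≠ 0 := by convert hb2 (2 * n + 4) using 1; ring
  have d6 : 1 - q ^ 6 * b ^ 2 * (q ^ n) ^ 2 ≠ 0 := by convert hb2 (2 * n + 5) using 1; ring
  have e1 : 1 - q * q ^ n ≠ 0 := one_sub_mul_pow_ne_zero hq hq n
  have A1 : qPoch (b * q) q n = qPoch b q n * (1 - b * q ^ n) / (1 - b) := by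
    rw [eq_div_iff h0, mul_comm, one_sub_mul_qPoch_shift]
  have A2 : qPoch (b * q ^ 2) q n =
      qPoch b q n * ((1 - b * q ^ n) * (1 - b * q * q ^ n)) / ((1 - b) * (1 - b * q)) := by
    rw [eq_div_iff (mul_ne_zero h0 h1)]
    have := one_sub_mul_qPoch_shift (b * q) q n
    rw [A1, mul_assoc b q q, ← pow_two] at this
    field_simp at this
    linear_combination this
  have D4 : qPoch (q * b ^ 2) q (2 * n + 4) = qPoch (q * b ^ 2) q (2 * n) *
      ((1 - q * b ^ 2 * (q ^ n) ^ 2) * (1 - q ^ 2 * b ^ 2 * (q ^ n) ^ 2) *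
        (1 - q ^ 3 * b ^ 2 * (q ^ n) ^ 2) * (1 - q ^ 4 * b ^ 2 * (q ^ n) ^ 2)) := by
    rw [qPoch_succ, qPoch_succ, qPoch_succ, qPoch_succ]
    ring
  have D6 : qPoch (q * b ^ 2) q (2 * (n + 1) + 4) = qPoch (q * b ^ 2) q (2 * n) *
      ((1 - q * b ^ 2 * (q ^ n) ^ 2) * (1 - q ^ 2 * b ^ 2 * (q ^ n) ^ 2) *
        (1 - q ^ 3 * b ^ 2 * (q ^ n) ^ 2) * (1 - q ^ 4 * b ^ 2 * (q ^ n) ^ 2)) *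
      ((1 - q ^ 5 * b ^ 2 * (q ^ n) ^ 2) * (1 - q ^ 6 * b ^ 2 * (q ^ n) ^ 2)) := by
    rw [← D4, show 2 * (n + 1) + 4 = 2 * n + 4 + 1 + 1 by ring, qPoch_succ, qPoch_succ]
    ring
  have D1 : qPoch (q * (b * q) ^ 2) q (2 * n) = qPoch (q * b ^ 2) q (2 * n) *
      ((1 - q * b ^ 2 * (q ^ n) ^ 2) * (1 - q ^ 2 * b ^ 2 * (q ^ n) ^ 2)) /
      ((1 - q * b ^ 2) * (1 - q ^ 2 * b ^ 2)) := by
    rw [eq_div_iff (mul_ne_zero c1 c2)]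
    have h := qPoch_add (q * b ^ 2) q 2 (2 * n)
    rw [add_comm, qPoch_succ, qPoch_succ, qPoch_succ, qPoch_one,
      show q * b ^ 2 * q ^ 2 = q * (b * q) ^ 2 by ring] at h
    linear_combination -h
  have D2 : qPoch (q * (b * q ^ 2) ^ 2) q (2 * n) = qPoch (q * b ^ 2) q (2 * n) *
      ((1 - q * b ^ 2 * (q ^ n) ^ 2) * (1 - q ^ 2 * b ^ 2 * (q ^ n) ^ 2) *
        (1 - q ^ 3 * b ^ 2 * (q ^ n) ^ 2) * (1 - q ^ 4 * b ^ 2 * (q ^ n) ^ 2)) /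
      ((1 - q * b ^ 2) * (1 - q ^ 2 * b ^ 2) * (1 - q ^ 3 * b ^ 2) * (1 - q ^ 4 * b ^ 2)) := by
    rw [eq_div_iff (by simp [c1, c2, c3, c4]), ← D4, add_comm (2 * n) 4, qPoch_add,
      show q * b ^ 2 * q ^ 4 = q * (b * q ^ 2) ^ 2 by ring, qPoch_succ, qPoch_succ, qPoch_succ,
      qPoch_one]
    ring
  -- Here `1 ≤ n` matters: at n = 0 the truncated 2n - 1 is 0, and the recurrence fails.
  have M1 : qPoch q q (2 * (n + 1) - 1) =
      qPoch q q (2 * n - 1) * ((1 - (q ^ n) ^ 2) * (1 - q * (q ^ n) ^ 2)) := by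
    obtain ⟨k, rfl⟩ : ∃ k, n = k + 1 := ⟨n - 1, by omega⟩
    rw [show 2 * (k + 1 + 1) - 1 = 2 * k + 1 + 1 + 1 by omega,
      show 2 * (k + 1) - 1 = 2 * k + 1 by omega, qPoch_succ, qPoch_succ q q (2 * k + 1)]
    ring
  have T0 : vwpTerm b q n = vwpKernel b q n * ((1 - b * (q ^ n) ^ 2) / (1 - b) *
      ((1 - q * b ^ 2 * (q ^ n) ^ 2) * (1 - q ^ 2 * b ^ 2 * (q ^ n) ^ 2) *
        (1 - q ^ 3 * b ^ 2 * (q ^ n) ^ 2) * (1 - q ^ 4 * b ^ 2 * (q ^ n) ^ 2))) := by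
    rw [vwpTerm, vwpKernel, D4, mul_comm 2 n, pow_mul, mul_comm n 2]
    -- With the denominators turned into independent symbols, the identity is a mere cancellation of
    -- like factors.
    generalize 1 - q * b ^ 2 * (q ^ n) ^ 2 = u₁ at d1 ⊢
    generalize 1 - q ^ 2 * b ^ 2 * (q ^ n) ^ 2 = u₂ at d2 ⊢
    generalize 1 - q ^ 3 * b ^ 2 * (q ^ n) ^ 2 = u₃ at d3 ⊢
    generalize 1 - q ^ 4 * b ^ 2 * (q ^ n) ^ 2 = u₄ at d4 ⊢
    generalize qPoch (q * b ^ 2) q (2 * n) = D at hD ⊢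
    generalize qPoch q q n = E at hE ⊢
    generalize (b * q) ^ n = Z
    generalize 1 - b = w₀ at h0 ⊢
    field_simp
  have T1 : vwpTerm (b * q) q n = vwpKernel b q n * ((1 - b * q * (q ^ n) ^ 2) / (1 - b * q) *
      ((1 - b * q ^ n) / (1 - b)) ^ 2 * q ^ n * ((1 - q * b ^ 2) * (1 - q ^ 2 * b ^ 2) *
          (1 - q ^ 3 * b ^ 2 * (q ^ n) ^ 2) * (1 - q ^ 4 * b ^ 2 * (q ^ n) ^ 2))) := by
    rw [vwpTerm, vwpKernel, D4, D1, A1, mul_comm 2 n, pow_mul, mul_comm n 2, mul_pow (b * q)]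
    generalize 1 - q * b ^ 2 * (q ^ n) ^ 2 = u₁ at d1 ⊢
    generalize 1 - q ^ 2 * b ^ 2 * (q ^ n) ^ 2 = u₂ at d2 ⊢
    generalize 1 - q ^ 3 * b ^ 2 * (q ^ n) ^ 2 = u₃ at d3 ⊢
    generalize 1 - q ^ 4 * b ^ 2 * (q ^ n) ^ 2 = u₄ at d4 ⊢
    generalize qPoch (q * b ^ 2) q (2 * n) = D at hD ⊢
    generalize qPoch q q n = E at hE ⊢
    generalize (b * q) ^ n = Z
    generalize 1 - q * b ^ 2 = v₁ at c1 ⊢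
    generalize 1 - q ^ 2 * b ^ 2 = v₂ at c2 ⊢
    generalize 1 - b = w₀ at h0 ⊢
    generalize 1 - b * q = w₁ at h1 ⊢
    field_simp
  have T2 : vwpTerm (b * q ^ 2) q n = vwpKernel b q n *
      ((1 - b * q ^ 2 * (q ^ n) ^ 2) / (1 - b * q ^ 2) *
        ((1 - b * q ^ n) * (1 - b * q * q ^ n) / ((1 - b) * (1 - b * q))) ^ 2 * (q ^ n) ^ 2 *
        ((1 - q * b ^ 2) * (1 - q ^ 2 * b ^ 2) * (1 - q ^ 3 * b ^ 2) * (1 - q ^ 4 * b ^ 2))) := by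
    rw [vwpTerm, vwpKernel, D4, D2, A2, mul_comm 2 n, pow_mul, mul_comm n 2,
      show b * q ^ 2 * q = b * q * (q * q) by ring, mul_pow (b * q), mul_pow q q]
    generalize 1 - q * b ^ 2 * (q ^ n) ^ 2 = u₁ at d1 ⊢
    generalize 1 - q ^ 2 * b ^ 2 * (q ^ n) ^ 2 = u₂ at d2 ⊢
    generalize 1 - q ^ 3 * b ^ 2 * (q ^ n) ^ 2 = u₃ at d3 ⊢
    generalize 1 - q ^ 4 * b ^ 2 * (q ^ n) ^ 2 = u₄ at d4 ⊢
    generalize qPoch (q * b ^ 2) q (2 * n) = D at hD ⊢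
    generalize qPoch q q n = E at hE ⊢
    generalize (b * q) ^ n = Z
    generalize 1 - q * b ^ 2 = v₁ at c1 ⊢
    generalize 1 - q ^ 2 * b ^ 2 = v₂ at c2 ⊢
    generalize 1 - q ^ 3 * b ^ 2 = v₃ at c3 ⊢
    generalize 1 - q ^ 4 * b ^ 2 = v₄ at c4 ⊢
    generalize 1 - b = w₀ at h0 ⊢
    generalize 1 - b * q ^ 2 = w₂ at h2 ⊢
    generalize 1 - b * q = w₁ at h1 ⊢
    field_simp
  have U : vwpAnti b q (n + 1) = vwpKernel b q n *
      ((1 - b * q ^ n) ^ 2 * (1 - (q ^ n) ^ 2) * (1 - q * (q ^ n) ^ 2) * (b * q) *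
        vwpPoly b q (q * q ^ n)) := by
    rw [vwpAnti, vwpKernel, vwpKernel, D4, D6, M1, qPoch_succ, qPoch_succ, pow_succ (b * q),
      pow_succ' q n,
      show q ^ 3 * b ^ 2 * (q * q ^ n) ^ 2 = q ^ 5 * b ^ 2 * (q ^ n) ^ 2 by ring,
      show q ^ 4 * b ^ 2 * (q * q ^ n) ^ 2 = q ^ 6 * b ^ 2 * (q ^ n) ^ 2 by ring]
    generalize 1 - q * b ^ 2 * (q ^ n) ^ 2 = u₁ at d1 ⊢
    generalize 1 - q ^ 2 * b ^ 2 * (q ^ n) ^ 2 = u₂ at d2 ⊢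
    generalize 1 - q ^ 3 * b ^ 2 * (q ^ n) ^ 2 = u₃ at d3 ⊢
    generalize 1 - q ^ 4 * b ^ 2 * (q ^ n) ^ 2 = u₄ at d4 ⊢
    generalize qPoch (q * b ^ 2) q (2 * n) = D at hD ⊢
    generalize qPoch q q n = E at hE ⊢
    generalize (b * q) ^ n = Z
    generalize 1 - q ^ 5 * b ^ 2 * (q ^ n) ^ 2 = u₅ at d5 ⊢
    generalize 1 - q ^ 6 * b ^ 2 * (q ^ n) ^ 2 = u₆ at d6 ⊢
    generalize vwpPoly b q (q * q ^ n) = y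
    rw [mul_comm q (q ^ n)] at e1
    rw [mul_comm q (q ^ n)]
    field_simp
  rw [T0, T1, T2, U, vwpAnti]
  linear_combination vwpKernel b q n * vwpPoly_certificate (q ^ n) h0 h1 h2

/-! ### Domination uniform in the shift of the parameter, and the boundary at infinity. -/

theorem one_sub_shift_ne_zero {a q : ℂ} (h : ∀ j : ℕ, 1 - a * q ^ j ≠ 0) (m j : ℕ) :
    1 - a * q ^ m * q ^ j ≠ 0 := by
  rw [mul_assoc, ← pow_add]
  exact h _

theorem exists_norm_inv_one_sub_le {a q : ℂ} (hq : ‖q‖ < 1) (h : ∀ j : ℕ, 1 - a * q ^ j ≠ 0) :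
    ∃ C, 0 < C ∧ ∀ m : ℕ, ‖(1 - a * q ^ m)⁻¹‖ ≤ C := by
  obtain ⟨C, hC, hb⟩ := exists_norm_inv_qPoch_shift_le hq h
  exact ⟨C, hC, fun m => by simpa [qPoch_one] using hb m 1⟩

theorem norm_one_sub_mul_pow_le {a q : ℂ} (hq : ‖q‖ < 1) (m : ℕ) :
    ‖1 - a * q ^ m‖ ≤ 1 + ‖a‖ :=
  (norm_sub_le _ _).trans (by rw [norm_one]; linarith [norm_mul_pow_le (a := a) hq m])

/-- The exponent n + 1 is at least 1, so one factor q^m is always available. This is why the terms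
of positive index decay in m, uniformly in n. -/
theorem norm_shift_pow_succ_le {z q : ℂ} (hq : ‖q‖ < 1) (m n : ℕ) :
    ‖(z * q ^ m) ^ (n + 1)‖ ≤ ‖q‖ ^ m * ‖z‖ ^ (n + 1) := by
  rw [norm_pow, norm_mul, norm_pow, mul_pow, mul_comm]
  gcongr
  exact pow_le_of_le_one (by positivity) (pow_le_one₀ (norm_nonneg _) hq.le) (Nat.succ_ne_zero n)

/-- A doubly indexed family dominated by `K r ^ m s ^ n` has sums over `n` tending to `0`. -/
theorem tendsto_tsum_of_norm_le {f : ℕ → ℕ → ℂ} {K r s : ℝ} (hr0 : 0 ≤ r) (hr : r < 1)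
    (hs0 : 0 ≤ s) (hs : s < 1) (h : ∀ m n, ‖f m n‖ ≤ K * (r ^ m * s ^ (n + 1))) :
    (∀ m, Summable (f m)) ∧ Tendsto (fun m => ∑' n, f m n) atTop (𝓝 0) := by
  have hsum : HasSum (fun n : ℕ => s ^ (n + 1)) (∑' n : ℕ, s ^ (n + 1)) :=
    ((summable_nat_add_iff 1).2 (summable_geometric_of_lt_one hs0 hs)).hasSum
  have hm : ∀ m, HasSum (fun n : ℕ => K * (r ^ m * s ^ (n + 1)))
      (K * (r ^ m * ∑' n : ℕ, s ^ (n + 1))) := fun m => (hsum.mul_left _).mul_left _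
  refine ⟨fun m => Summable.of_norm_bounded (hm m).summable (h m), ?_⟩
  refine squeeze_zero_norm (fun m => tsum_of_norm_bounded (hm m) (h m)) ?_
  simpa using ((tendsto_pow_atTop_nhds_zero_of_lt_one hr0 hr).mul_const
    (∑' n : ℕ, s ^ (n + 1))).const_mul K

theorem exists_norm_vwpTerm_le {b q : ℂ} (hq : ‖q‖ < 1) (hb : ∀ j : ℕ, 1 - b * q ^ j ≠ 0)
    (hb2 : ∀ j : ℕ, 1 - q * b ^ 2 * q ^ j ≠ 0) :
    ∃ K, ∀ m n : ℕ, ‖vwpTerm (b * q ^ m) q (n + 1)‖ ≤ K * (‖q‖ ^ m * ‖b * q‖ ^ (n + 1)) := by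
  obtain ⟨C, hC, hCb⟩ := exists_norm_qPoch_le hq (‖b‖ + 1)
  obtain ⟨E, hE, hEb⟩ := exists_norm_inv_qPoch_le hq (one_sub_mul_pow_ne_zero hq hq)
  obtain ⟨D, hD, hDb⟩ := exists_norm_inv_qPoch_shift_le hq hb2
  obtain ⟨B, hB, hBb⟩ := exists_norm_inv_one_sub_le hq hb
  refine ⟨(1 + ‖b‖) * B * (C * C * C * (E * E * D)), fun m n => ?_⟩
  have e : vwpTerm (b * q ^ m) q (n + 1) =
      (1 - b * q ^ (m + 2 * (n + 1))) * (1 - b * q ^ m)⁻¹ *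
      (qPoch (b * q ^ m) q (n + 1) * qPoch (b * q ^ m) q (n + 1) *
        qPoch q q (2 * (n + 1) - 1) * ((qPoch q q (n + 1))⁻¹ * (qPoch q q (n + 1))⁻¹ *
        (qPoch (q * b ^ 2 * q ^ (2 * m)) q (2 * (n + 1)))⁻¹)) * (b * q * q ^ m) ^ (n + 1) := by
    rw [vwpTerm, pow_add q m, show q * (b * q ^ m) ^ 2 = q * b ^ 2 * q ^ (2 * m) by ring,
      show b * q ^ m * q = b * q * q ^ m by ring, div_eq_mul_inv, div_eq_mul_inv, mul_inv, mul_inv]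
    ring
  have hbm : ‖b * q ^ m‖ ≤ ‖b‖ + 1 := (norm_mul_pow_le hq m).trans (by linarith)
  have hq' : ‖q‖ ≤ ‖b‖ + 1 := by linarith [norm_nonneg b]
  rw [e]
  simp only [norm_mul]
  have := norm_shift_pow_succ_le (z := b * q) hq m n
  rw [norm_mul] at this
  gcongr
  · exact norm_one_sub_mul_pow_le hq _
  · exact hBb m
  · exact hCb _ hbm _
  · exact hCb _ hbm _
  · exact hCb _ hq' _
  · exact hEb _
  · exact hEb _
  · exact hDb _ _

/-- The kernel is O(|bq|^n), while the remaining factor is a polynomial in q^n and so has a limit.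
-/
theorem tendsto_vwpAnti {b q : ℂ} (hq : ‖q‖ < 1) (hbq : ‖b * q‖ < 1)
    (hb2 : ∀ j : ℕ, 1 - q * b ^ 2 * q ^ j ≠ 0) :
    Tendsto (vwpAnti b q) atTop (𝓝 0) := by
  obtain ⟨C, hC, hCb⟩ := exists_norm_qPoch_le hq (‖b‖ + 1)
  obtain ⟨E, hE, hEb⟩ := exists_norm_inv_qPoch_le hq (one_sub_mul_pow_ne_zero hq hq)
  obtain ⟨D, hD, hDb⟩ := exists_norm_inv_qPoch_le hq hb2
  have hk : Tendsto (vwpKernel b q) atTop (𝓝 0) := by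
    refine squeeze_zero_norm (a := fun n => C ^ 2 * C * ‖b * q‖ ^ n * (E ^ 2 * D)) (fun n => ?_) ?_
    · have hb' : ‖b‖ ≤ ‖b‖ + 1 := by linarith
      have hq' : ‖q‖ ≤ ‖b‖ + 1 := by linarith [norm_nonneg b]
      rw [vwpKernel, div_eq_mul_inv, mul_inv, ← inv_pow]
      simp only [norm_mul, norm_pow]
      gcongr
      · exact hCb _ hb' _
      · exact hCb _ hq' _
      · exact hEb _
      · exact hDb _
    · simpa using ((tendsto_pow_atTop_nhds_zero_of_lt_one (norm_nonneg _) hbq).const_mul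
        (C ^ 2 * C)).mul_const (E ^ 2 * D)
  have hx := tendsto_pow_atTop_nhds_zero_of_norm_lt_one hq
  have hc : Continuous fun x : ℂ => (1 - x) ^ 2 * (1 - q ^ 3 * b ^ 2 * x ^ 2) *
      (1 - q ^ 4 * b ^ 2 * x ^ 2) * vwpPoly b q x := by
    unfold vwpPoly
    fun_prop
  have := ((hc.tendsto 0).comp hx).mul hk
  rw [mul_zero] at this
  exact this

/-! ### Summing the second-order relation to a Lambert-type series. -/

/-- The first `q`-difference of the very-well-poised series. -/
noncomputable def vwpDiff (b q : ℂ) : ℂ :=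
  b * q / (1 - b * q) - b ^ 2 * q / (1 - b ^ 2 * q) - b ^ 2 * q ^ 2 / (1 - b ^ 2 * q ^ 2)

/-- The boundary term at n = 1 is itself a q-difference in b, which lets the second-order relation
be integrated once. -/
theorem vwpAnti_one {b q : ℂ} (hq : ‖q‖ < 1) (hb : ∀ j : ℕ, 1 - b * q ^ j ≠ 0)
    (hb2 : ∀ j : ℕ, 1 - q * b ^ 2 * q ^ j ≠ 0) :
    vwpAnti b q 1 = vwpDiff b q - vwpDiff (b * q) q := by
  have hq1 : 1 - q ≠ 0 := one_sub_ne_zero_of_norm_lt_one hq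
  have h0 : 1 - b ≠ 0 := by simpa using hb 0
  have h1 : 1 - b * q ≠ 0 := by simpa using hb 1
  have h2 : 1 - b * q ^ 2 ≠ 0 := hb 2
  have c1 : 1 - b ^ 2 * q ≠ 0 := by convert hb2 0 using 1; ring
  have c2 : 1 - b ^ 2 * q ^ 2 ≠ 0 := by convert hb2 1 using 1; ring
  have c3 : 1 - b ^ 2 * q ^ 3 ≠ 0 := by convert hb2 2 using 1; ring
  have c4 : 1 - b ^ 2 * q ^ 4 ≠ 0 := by convert hb2 3 using 1; ring
  have c5 : 1 - b ^ 2 * q ^ 5 ≠ 0 := by convert hb2 4 using 1; ring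
  have c6 : 1 - b ^ 2 * q ^ 6 ≠ 0 := by convert hb2 5 using 1; ring
  have hD : qPoch (q * b ^ 2) q (2 * 1 + 4) = (1 - b ^ 2 * q) * (1 - b ^ 2 * q ^ 2) *
      (1 - b ^ 2 * q ^ 3) * (1 - b ^ 2 * q ^ 4) * (1 - b ^ 2 * q ^ 5) * (1 - b ^ 2 * q ^ 6) := by
    simp only [qPoch, Finset.prod_range_succ, Finset.prod_range_zero]
    ring
  have hk : vwpAnti b q 1 = (1 - b) ^ 2 * (1 - q) * (b * q) * vwpPoly b q q /
      ((1 - b ^ 2 * q) * (1 - b ^ 2 * q ^ 2) * (1 - b ^ 2 * q ^ 3) * (1 - b ^ 2 * q ^ 4)) := by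
    rw [vwpAnti, vwpKernel, hD, show 2 * 1 - 1 = 1 from rfl, qPoch_one, qPoch_one]
    simp only [pow_one]
    rw [show 1 - q ^ 3 * b ^ 2 * q ^ 2 = 1 - b ^ 2 * q ^ 5 by ring,
      show 1 - q ^ 4 * b ^ 2 * q ^ 2 = 1 - b ^ 2 * q ^ 6 by ring]
    generalize 1 - b ^ 2 * q ^ 5 = u at c5 ⊢
    generalize 1 - b ^ 2 * q ^ 6 = v at c6 ⊢
    field_simp
  have hd : vwpDiff (b * q) q = b * q ^ 2 / (1 - b * q ^ 2) - b ^ 2 * q ^ 3 / (1 - b ^ 2 * q ^ 3) -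
      b ^ 2 * q ^ 4 / (1 - b ^ 2 * q ^ 4) := by
    rw [vwpDiff]
    ring_nf
  rw [hk, hd, vwpDiff, vwpPoly]
  field_simp
  ring

theorem vwp_second_difference {b q : ℂ} (hq : ‖q‖ < 1) (hbq : ‖b * q‖ < 1)
    (hb : ∀ j : ℕ, 1 - b * q ^ j ≠ 0) (hb2 : ∀ j : ℕ, 1 - q * b ^ 2 * q ^ j ≠ 0)
    (h0 : Summable fun n => vwpTerm b q (n + 1))
    (h1 : Summable fun n => vwpTerm (b * q) q (n + 1))
    (h2 : Summable fun n => vwpTerm (b * q ^ 2) q (n + 1)) :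
    (∑' n, vwpTerm b q (n + 1)) - 2 * (∑' n, vwpTerm (b * q) q (n + 1)) +
      (∑' n, vwpTerm (b * q ^ 2) q (n + 1)) = vwpDiff b q - vwpDiff (b * q) q := by
  have hs := ((h0.hasSum.sub (h1.hasSum.mul_left 2)).add h2.hasSum).tendsto_sum_nat
  refine tendsto_nhds_unique hs ?_
  have ht : Tendsto (fun n => vwpAnti b q 1 - vwpAnti b q (n + 1)) atTop
      (𝓝 (vwpAnti b q 1 - 0)) :=
    ((tendsto_vwpAnti hq hbq hb2).comp (tendsto_add_atTop_nat 1)).const_sub _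
  rw [sub_zero, vwpAnti_one hq hb hb2] at ht
  rw [← vwpAnti_one hq hb hb2] at ht ⊢
  refine ht.congr fun n => ?_
  rw [← Finset.sum_range_sub' (fun k => vwpAnti b q (k + 1))]
  exact Finset.sum_congr rfl fun k _ => (vwpTerm_telescope hq hb hb2 (Nat.le_add_left 1 k)).symm

/-- By the second-difference relation, F(b) - F(bq) - D(b) is the same at b and at bq, where F is
the series and D is `vwpDiff`. All three parts tend to 0 along b q^m, so the constant is 0. Then D(b
q^m) = F(b q^m) - F(b q^(m+1)) telescopes to F(b). -/
theorem tendsto_sum_vwpDiff {b q : ℂ} (hq : ‖q‖ < 1) (hbq : ‖b * q‖ < 1)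
    (hb : ∀ j : ℕ, 1 - b * q ^ j ≠ 0) (hb2 : ∀ j : ℕ, 1 - q * b ^ 2 * q ^ j ≠ 0) :
    ∃ S, HasSum (fun n => vwpTerm b q (n + 1)) S ∧
      Tendsto (fun N => ∑ m ∈ Finset.range N, vwpDiff (b * q ^ m) q) atTop (𝓝 S) := by
  obtain ⟨K, hK⟩ := exists_norm_vwpTerm_le hq hb hb2
  obtain ⟨hsum, hlim⟩ := tendsto_tsum_of_norm_le (norm_nonneg q) hq (norm_nonneg _) hbq hK
  set F : ℕ → ℂ := fun m => ∑' n, vwpTerm (b * q ^ m) q (n + 1) with hF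
  have hrec : ∀ m, F m - F (m + 1) - vwpDiff (b * q ^ m) q =
      F (m + 1) - F (m + 2) - vwpDiff (b * q ^ (m + 1)) q := by
    intro m
    have e1 : b * q ^ m * q = b * q ^ (m + 1) := by ring
    have e2 : b * q ^ m * q ^ 2 = b * q ^ (m + 2) := by ring
    have hn : ‖b * q ^ m * q‖ < 1 := by
      rw [show b * q ^ m * q = b * q * q ^ m by ring]
      exact (norm_mul_pow_le hq m).trans_lt hbq
    have := vwp_second_difference hq hn (one_sub_shift_ne_zero hb m)
      (fun j => by
        convert one_sub_shift_ne_zero hb2 (2 * m) j using 1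
        ring) (hsum m) (by rw [e1]; exact hsum (m + 1)) (by rw [e2]; exact hsum (m + 2))
    rw [e1, e2] at this
    simp only [hF]
    linear_combination this
  have hconst : ∀ m, F m - F (m + 1) - vwpDiff (b * q ^ m) q =
      F 0 - F 1 - vwpDiff (b * q ^ 0) q := by
    intro m
    induction m with
    | zero => rfl
    | succ m ih => rw [← ih, hrec m]
  have hd0 : Tendsto (fun m : ℕ => vwpDiff (b * q ^ m) q) atTop (𝓝 0) := by
    have hx : Tendsto (fun m : ℕ => b * q ^ m) atTop (𝓝 0) := by
      simpa using (tendsto_pow_atTop_nhds_zero_of_norm_lt_one hq).const_mul b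
    have hc : ContinuousAt (fun x : ℂ => vwpDiff x q) 0 := by
      unfold vwpDiff
      refine ((ContinuousAt.div ?_ ?_ ?_).sub (ContinuousAt.div ?_ ?_ ?_)).sub
        (ContinuousAt.div ?_ ?_ ?_) <;> first | fun_prop | simp
    have := hc.tendsto.comp hx
    simpa [vwpDiff, Function.comp_def] using this
  have hzero : F 0 - F 1 - vwpDiff (b * q ^ 0) q = 0 := by
    have h1 : Tendsto (fun m => F m - F (m + 1) - vwpDiff (b * q ^ m) q) atTop (𝓝 (0 - 0 - 0)) :=
      (hlim.sub (hlim.comp (tendsto_add_atTop_nat 1))).sub hd0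
    have h2 := h1.congr hconst
    simpa using tendsto_nhds_unique tendsto_const_nhds h2
  refine ⟨F 0, by simpa [hF] using (hsum 0).hasSum, ?_⟩
  have ht : Tendsto (fun N => F 0 - F N) atTop (𝓝 (F 0 - 0)) := hlim.const_sub _
  rw [sub_zero] at ht
  refine ht.congr fun N => ?_
  rw [← Finset.sum_range_sub' F]
  exact Finset.sum_congr rfl fun m _ => by linear_combination (hconst m).trans hzero

/-! ### Gauss' product for ψ. -/

/-- The finite products `∏ (1 - q^(2i)) / (1 - q^(2i-1))` converging to `ψ(q)`. -/
noncomputable def psiProd (q : ℂ) (n : ℕ) : ℂ :=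
  qPoch (q ^ 2) (q ^ 2) n / qPoch q (q ^ 2) n

theorem one_sub_odd_pow_ne_zero {q : ℂ} (hq : ‖q‖ < 1) (j : ℕ) : 1 - q * (q ^ 2) ^ j ≠ 0 := by
  rw [← pow_mul]
  exact one_sub_mul_pow_ne_zero hq hq _

theorem norm_pow_lt_one {q : ℂ} (hq : ‖q‖ < 1) {k : ℕ} (hk : k ≠ 0) : ‖q ^ k‖ < 1 := by
  rw [norm_pow]
  exact pow_lt_one₀ (norm_nonneg _) hq hk

theorem psiProd_ne_zero {q : ℂ} (hq : ‖q‖ < 1) (n : ℕ) : psiProd q n ≠ 0 :=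
  div_ne_zero (qPoch_ne_zero (one_sub_mul_pow_ne_zero (norm_pow_lt_one hq two_ne_zero)
    (norm_pow_lt_one hq two_ne_zero)) n) (qPoch_ne_zero (one_sub_odd_pow_ne_zero hq) n)

theorem psiProd_succ (q : ℂ) (n : ℕ) :
    psiProd q (n + 1) = psiProd q n * ((1 - q ^ (2 * n + 2)) / (1 - q ^ (2 * n + 1))) := by
  rw [psiProd, psiProd, qPoch_succ, qPoch_succ, div_mul_div_comm]
  ring_nf

/-- Shanks' finite form of Gauss' product for `ψ`. -/
theorem sum_triangular_pow {q : ℂ} (hq : ‖q‖ < 1) (n : ℕ) :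
    ∑ s ∈ Finset.range (2 * n), q ^ (s * (s + 1) / 2) =
      ∑ s ∈ Finset.range n, psiProd q n / psiProd q s * q ^ (s * (2 * n + 1)) := by
  induction n with
  | zero => simp
  | succ n ih =>
    have hY : 1 - q ^ (2 * n + 1) ≠ 0 := one_sub_ne_zero_of_norm_lt_one (norm_pow_lt_one hq (by omega))
    -- `H` is an antidifference in s of the change of the s-th summand when n becomes n + 1. It
    -- vanishes at s = 0 through the factor 1 - q^(2s).
    set H : ℕ → ℂ := fun s => (1 - q ^ (2 * s)) / (1 - q ^ (2 * n + 1)) *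
      (psiProd q n / psiProd q s * q ^ (s * (2 * n + 1))) with hH
    have hstep : ∀ s, psiProd q (n + 1) / psiProd q s * q ^ (s * (2 * (n + 1) + 1)) -
        psiProd q n / psiProd q s * q ^ (s * (2 * n + 1)) = H (s + 1) - H s := by
      intro s
      have h1 : 1 - q ^ (2 * s + 1) ≠ 0 :=
        one_sub_ne_zero_of_norm_lt_one (norm_pow_lt_one hq (by omega))
      have h2 : 1 - q ^ (2 * s + 2) ≠ 0 :=
        one_sub_ne_zero_of_norm_lt_one (norm_pow_lt_one hq (by omega))
      have hp := psiProd_ne_zero hq s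
      simp only [hH, psiProd_succ]
      rw [show s * (2 * (n + 1) + 1) = s * (2 * n + 1) + 2 * s by ring,
        show (s + 1) * (2 * n + 1) = s * (2 * n + 1) + (2 * n + 1) by ring,
        show 2 * (s + 1) = 2 * s + 2 by ring]
      have e : q ^ (2 * n + 2) = q ^ (2 * n + 1) * q := pow_succ _ _
      have e1 : q ^ (2 * s + 1) = q ^ (2 * s) * q := pow_succ _ _
      rw [pow_add q (s * (2 * n + 1)), pow_add q (s * (2 * n + 1)), e]
      rw [e1] at h1 ⊢
      clear e e1
      generalize q ^ (2 * n + 1) = Y at hY ⊢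
      generalize q ^ (s * (2 * n + 1)) = Z
      generalize 1 - q ^ (2 * s + 2) = u at h2 ⊢
      generalize q ^ (2 * s) = X at h1 ⊢
      field_simp
      ring
    have hsum := Finset.sum_range_sub H n
    rw [← Finset.sum_congr rfl fun s _ => hstep s, Finset.sum_sub_distrib] at hsum
    have hH0 : H 0 = 0 := by simp [hH]
    rw [show 2 * (n + 1) = 2 * n + 1 + 1 by ring, Finset.sum_range_succ, Finset.sum_range_succ, ih,
      Finset.sum_range_succ _ n]
    have t1 : 2 * n * (2 * n + 1) / 2 = n * (2 * n + 1) := by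
      rw [mul_assoc, Nat.mul_div_cancel_left _ two_pos]
    have t2 : (2 * n + 1) * (2 * n + 1 + 1) / 2 = n * (2 * n + 1) + (2 * n + 1) := by
      rw [show (2 * n + 1) * (2 * n + 1 + 1) = 2 * (n * (2 * n + 1) + (2 * n + 1)) by ring,
        Nat.mul_div_cancel_left _ two_pos]
    rw [t1, t2, show 2 * n + 1 + 1 = 2 * (n + 1) by ring]
    -- The new summand s = n and the boundary value `H n` together supply the two new triangular
    -- powers, of indices 2n and 2n + 1.
    have hlast : psiProd q (n + 1) / psiProd q n * q ^ (n * (2 * (n + 1) + 1)) + H n =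
        q ^ (n * (2 * n + 1)) + q ^ (n * (2 * n + 1) + (2 * n + 1)) := by
      have hp := psiProd_ne_zero hq n
      simp only [hH, psiProd_succ]
      rw [show n * (2 * (n + 1) + 1) = n * (2 * n + 1) + 2 * n by ring,
        pow_add q (n * (2 * n + 1)), pow_add q (n * (2 * n + 1))]
      have e : q ^ (2 * n + 2) = q ^ (2 * n + 1) * q := pow_succ _ _
      have e1 : q ^ (2 * n + 1) = q ^ (2 * n) * q := pow_succ _ _
      rw [e1] at hY
      rw [e, e1]
      clear e e1
      generalize q ^ (2 * n) = X at hY ⊢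
      field_simp
      ring
    rw [hH0] at hsum
    linear_combination -hsum - hlast

/-- In Shanks' identity the summand s = 0 is exactly `psiProd q n`. The other n - 1 summands are
each O(|q|^n), since the quotients of products are uniformly bounded. -/
theorem tendsto_psiProd {q : ℂ} (hq : ‖q‖ < 1) :
    Tendsto (psiProd q) atTop (𝓝 (ramanujanPsi q)) := by
  have hq2 : ‖q ^ 2‖ < 1 := norm_pow_lt_one hq two_ne_zero
  have hs : Summable fun n : ℕ => q ^ (n * (n + 1) / 2) := by
    refine Summable.of_norm_bounded (summable_geometric_of_lt_one (norm_nonneg q) hq) fun n => ?_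
    rw [norm_pow]
    refine pow_le_pow_of_le_one (norm_nonneg _) hq.le ?_
    rw [Nat.le_div_iff_mul_le two_pos]
    rcases n with _ | n
    · simp
    · exact Nat.mul_le_mul_left _ (by omega)
  have hlim := hs.hasSum.tendsto_sum_nat.comp
    (tendsto_id.const_mul_atTop' (two_pos : 0 < 2))
  obtain ⟨C, hC, hCb⟩ := exists_norm_qPoch_le hq2 1
  obtain ⟨D, hD, hDb⟩ := exists_norm_inv_qPoch_le hq2 (one_sub_mul_pow_ne_zero hq2 hq2)
  obtain ⟨E, hE, hEb⟩ := exists_norm_inv_qPoch_le hq2 (one_sub_odd_pow_ne_zero hq)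
  have hbound : ∀ n s, ‖psiProd q n / psiProd q s‖ ≤ C * E * (D * C) := by
    intro n s
    rw [psiProd, psiProd, div_eq_mul_inv, inv_div, div_eq_mul_inv, div_eq_mul_inv,
      mul_comm (qPoch q _ s)]
    simp only [norm_mul]
    gcongr
    · exact hCb _ hq2.le _
    · exact hEb _
    · exact hDb _
    · exact hCb _ hq.le _
  have herr : Tendsto (fun n => ∑ s ∈ Finset.range (2 * n), q ^ (s * (s + 1) / 2) - psiProd q n)
      atTop (𝓝 0) := by
    refine squeeze_zero_norm' (a := fun n : ℕ => C * E * (D * C) * (n * ‖q‖ ^ n)) ?_ ?_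
    · filter_upwards [eventually_ge_atTop 1] with n hn
      obtain ⟨k, rfl⟩ : ∃ k, n = k + 1 := ⟨n - 1, by omega⟩
      rw [sum_triangular_pow hq, Finset.sum_range_succ']
      have h0 : psiProd q (k + 1) / psiProd q 0 * q ^ (0 * (2 * (k + 1) + 1)) =
          psiProd q (k + 1) := by simp [psiProd, qPoch_zero]
      rw [h0, add_sub_cancel_right]
      calc _ ≤ ∑ s ∈ Finset.range k, C * E * (D * C) * ‖q‖ ^ (k + 1) := by
            refine norm_sum_le_of_le _ fun s _ => ?_
            rw [norm_mul, norm_pow]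
            refine mul_le_mul (hbound _ _) ?_ (by positivity) (by positivity)
            refine pow_le_pow_of_le_one (norm_nonneg _) hq.le ?_
            nlinarith
        _ = k * (C * E * (D * C) * ‖q‖ ^ (k + 1)) := by simp
        _ ≤ _ := by
            push_cast
            have : 0 ≤ C * E * (D * C) * ‖q‖ ^ (k + 1) := by positivity
            linarith
    · simpa using (tendsto_self_mul_const_pow_of_lt_one (norm_nonneg q) hq).const_mul
        (C * E * (D * C))
  have := hlim.sub herr
  simpa [Function.comp_def, ramanujanPsi] using this

/-! ### The nonterminating `₆φ₅` summation. -/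

/-- Summand of the very-well-poised `₆φ₅` series with argument `z = a q / (b c d)`. -/
noncomputable def sixPhiTerm (a b c d q z : ℂ) (n : ℕ) : ℂ :=
  (1 - a * q ^ (2 * n)) / (1 - a) *
    (qPoch a q n * qPoch b q n * qPoch c q n * qPoch d q n /
      (qPoch q q n * qPoch (z * c * d) q n * qPoch (z * b * d) q n * qPoch (z * b * c) q n)) *
    z ^ n

/-- The quotient of the `₆φ₅` sums at `(a, z)` and `(a q, z q)`. -/
noncomputable def sixPhiRatio (a b c d q z : ℂ) : ℂ :=
  (1 - a * q) * (1 - z * b) * (1 - z * c) * (1 - z * d) /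
    ((1 - z * c * d) * (1 - z * b * d) * (1 - z * b * c) * (1 - z))

/-- Common factor of `sixPhiTerm` and its shift. -/
noncomputable def sixPhiKernel (a b c d q z : ℂ) (n : ℕ) : ℂ :=
  qPoch a q n * qPoch b q n * qPoch c q n * qPoch d q n * z ^ n /
    (qPoch q q n * qPoch (z * c * d) q (n + 1) * qPoch (z * b * d) q (n + 1) *
      qPoch (z * b * c) q (n + 1))

/-- Antidifference of the contiguous relation for `sixPhiTerm`. -/
noncomputable def sixPhiAnti (a b c d q z : ℂ) (n : ℕ) : ℂ :=
  (1 - q ^ n) * (1 - z * c * d * q ^ n) * (1 - z * b * d * q ^ n) * (1 - z * b * c * q ^ n) *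
    (-(1 - a * z * q ^ n) / ((1 - a) * (1 - z))) * sixPhiKernel a b c d q z n

/-- This is the contiguous relation between (a, z) and (aq, zq), divided by `sixPhiKernel`, with x
for q^n. With b, c, d fixed this shift preserves the balancing condition aq = zbcd, so it can be
iterated. -/
theorem sixPhi_certificate {a b c d q z : ℂ} (x : ℂ) (h : a * q = z * b * c * d)
    (ha : 1 - a ≠ 0) (hz : 1 - z ≠ 0) :
    (1 - a * x ^ 2) / (1 - a) *
        ((1 - z * c * d * x) * (1 - z * b * d * x) * (1 - z * b * c * x)) -
      (1 - z * b) * (1 - z * c) * (1 - z * d) * (1 - a * q * x ^ 2) * (1 - a * x) * x /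
        ((1 - z) * (1 - a)) =
    z * (1 - a * x) * (1 - b * x) * (1 - c * x) * (1 - d * x) *
        (-(1 - a * z * (q * x)) / ((1 - a) * (1 - z))) -
      (1 - x) * (1 - z * c * d * x) * (1 - z * b * d * x) * (1 - z * b * c * x) *
        (-(1 - a * z * x) / ((1 - a) * (1 - z))) := by
  rw [show a * z * (q * x) = a * q * z * x by ring, h]
  field_simp
  ring

set_option maxHeartbeats 1000000 in
theorem sixPhiTerm_telescope {a b c d q z : ℂ} (h : a * q = z * b * c * d) (hq : ‖q‖ < 1)
    (hz : 1 - z ≠ 0) (ha : ∀ j : ℕ, 1 - a * q ^ j ≠ 0)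
    (hcd : ∀ j : ℕ, 1 - z * c * d * q ^ j ≠ 0) (hbd : ∀ j : ℕ, 1 - z * b * d * q ^ j ≠ 0)
    (hbc : ∀ j : ℕ, 1 - z * b * c * q ^ j ≠ 0) (n : ℕ) :
    sixPhiTerm a b c d q z n -
        sixPhiRatio a b c d q z * sixPhiTerm (a * q) b c d q (z * q) n =
      sixPhiAnti a b c d q z (n + 1) - sixPhiAnti a b c d q z n := by
  have h0 : 1 - a ≠ 0 := by simpa using ha 0
  have h1 : 1 - a * q ≠ 0 := by simpa using ha 1
  have u0 : 1 - z * c * d ≠ 0 := by simpa using hcd 0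
  have v0 : 1 - z * b * d ≠ 0 := by simpa using hbd 0
  have w0 : 1 - z * b * c ≠ 0 := by simpa using hbc 0
  have un := hcd n
  have vn := hbd n
  have wn := hbc n
  have un' : 1 - z * c * d * q ^ (n + 1) ≠ 0 := hcd (n + 1)
  have vn' : 1 - z * b * d * q ^ (n + 1) ≠ 0 := hbd (n + 1)
  have wn' : 1 - z * b * c * q ^ (n + 1) ≠ 0 := hbc (n + 1)
  have hE : qPoch q q n ≠ 0 := qPoch_ne_zero (one_sub_mul_pow_ne_zero hq hq) n
  have hU : qPoch (z * c * d) q n ≠ 0 := qPoch_ne_zero hcd n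
  have hV : qPoch (z * b * d) q n ≠ 0 := qPoch_ne_zero hbd n
  have hW : qPoch (z * b * c) q n ≠ 0 := qPoch_ne_zero hbc n
  have hU' : qPoch (z * c * d) q (n + 1) ≠ 0 := qPoch_ne_zero hcd _
  have hV' : qPoch (z * b * d) q (n + 1) ≠ 0 := qPoch_ne_zero hbd _
  have hW' : qPoch (z * b * c) q (n + 1) ≠ 0 := qPoch_ne_zero hbc _
  have hs : ∀ x : ℂ, 1 - x ≠ 0 →
      qPoch (x * q) q n = qPoch x q n * (1 - x * q ^ n) / (1 - x) := fun x hx => by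
    rw [eq_div_iff hx, mul_comm, one_sub_mul_qPoch_shift]
  have e1 : 1 - q ^ (n + 1) ≠ 0 :=
    one_sub_ne_zero_of_norm_lt_one (norm_pow_lt_one hq (Nat.succ_ne_zero n))
  have T0 : sixPhiTerm a b c d q z n = sixPhiKernel a b c d q z n *
      ((1 - a * (q ^ n) ^ 2) / (1 - a) *
        ((1 - z * c * d * q ^ n) * (1 - z * b * d * q ^ n) * (1 - z * b * c * q ^ n))) := by
    rw [sixPhiTerm, sixPhiKernel, qPoch_succ, qPoch_succ, qPoch_succ, mul_comm 2 n, pow_mul]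
    generalize 1 - z * c * d * q ^ n = u at un ⊢
    generalize 1 - z * b * d * q ^ n = v at vn ⊢
    generalize 1 - z * b * c * q ^ n = w at wn ⊢
    generalize qPoch (z * c * d) q n = U at hU ⊢
    generalize qPoch (z * b * d) q n = V at hV ⊢
    generalize qPoch (z * b * c) q n = W at hW ⊢
    field_simp
  have T1 : sixPhiRatio a b c d q z * sixPhiTerm (a * q) b c d q (z * q) n =
      sixPhiKernel a b c d q z n *
      ((1 - z * b) * (1 - z * c) * (1 - z * d) * (1 - a * q * (q ^ n) ^ 2) * (1 - a * q ^ n) *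
        q ^ n / ((1 - z) * (1 - a))) := by
    rw [sixPhiTerm, sixPhiKernel, sixPhiRatio, qPoch_succ, qPoch_succ, qPoch_succ, mul_comm 2 n,
      pow_mul, hs a h0, show z * q * c * d = z * c * d * q by ring,
      show z * q * b * d = z * b * d * q by ring, show z * q * b * c = z * b * c * q by ring,
      hs _ u0, hs _ v0, hs _ w0, mul_pow z q n]
    generalize 1 - z * c * d * q ^ n = u at un ⊢
    generalize 1 - z * b * d * q ^ n = v at vn ⊢
    generalize 1 - z * b * c * q ^ n = w at wn ⊢
    generalize qPoch (z * c * d) q n = U at hU ⊢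
    generalize qPoch (z * b * d) q n = V at hV ⊢
    generalize qPoch (z * b * c) q n = W at hW ⊢
    generalize 1 - z * c * d = u' at u0 ⊢
    generalize 1 - z * b * d = v' at v0 ⊢
    generalize 1 - z * b * c = w' at w0 ⊢
    generalize 1 - a * q = a₁ at h1 ⊢
    generalize 1 - a = a₀ at h0 ⊢
    generalize 1 - z = z₀ at hz ⊢
    generalize qPoch q q n = E at hE ⊢
    generalize 1 - a * q ^ n = f₁
    generalize 1 - a * q * (q ^ n) ^ 2 = f₂
    generalize 1 - z * b = f₃
    generalize 1 - z * c = f₄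
    generalize 1 - z * d = f₅
    generalize qPoch a q n = A
    generalize qPoch b q n = B
    generalize qPoch c q n = C
    generalize qPoch d q n = D
    generalize q ^ n = X
    generalize z ^ n = Z
    field_simp
  have T2 : sixPhiAnti a b c d q z (n + 1) = sixPhiKernel a b c d q z n *
      (z * (1 - a * q ^ n) * (1 - b * q ^ n) * (1 - c * q ^ n) * (1 - d * q ^ n) *
        (-(1 - a * z * (q * q ^ n)) / ((1 - a) * (1 - z)))) := by
    rw [sixPhiAnti, sixPhiKernel, sixPhiKernel, qPoch_succ _ _ (n + 1), qPoch_succ _ _ (n + 1),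
      qPoch_succ _ _ (n + 1), qPoch_succ a, qPoch_succ b, qPoch_succ c, qPoch_succ d,
      qPoch_succ q q n, pow_succ z, ← pow_succ' q n]
    generalize qPoch (z * c * d) q (n + 1) = U at hU' ⊢
    generalize qPoch (z * b * d) q (n + 1) = V at hV' ⊢
    generalize qPoch (z * b * c) q (n + 1) = W at hW' ⊢
    generalize 1 - z * c * d * q ^ (n + 1) = u at un' ⊢
    generalize 1 - z * b * d * q ^ (n + 1) = v at vn' ⊢
    generalize 1 - z * b * c * q ^ (n + 1) = w at wn' ⊢
    generalize 1 - a * z * q ^ (n + 1) = y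
    generalize 1 - q ^ (n + 1) = e at e1 ⊢
    generalize 1 - a = a₀ at h0 ⊢
    generalize 1 - z = z₀ at hz ⊢
    generalize qPoch q q n = E at hE ⊢
    generalize 1 - a * q ^ n = f₁
    generalize 1 - b * q ^ n = f₂
    generalize 1 - c * q ^ n = f₃
    generalize 1 - d * q ^ n = f₄
    generalize qPoch a q n = A
    generalize qPoch b q n = B
    generalize qPoch c q n = C
    generalize qPoch d q n = D
    generalize z ^ n = Z
    field_simp
  rw [T0, T1, T2, sixPhiAnti]
  linear_combination sixPhiKernel a b c d q z n * sixPhi_certificate (q ^ n) h h0 hz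

theorem tendsto_sixPhiAnti {a b c d q z : ℂ} (hq : ‖q‖ < 1) (hz : ‖z‖ < 1)
    (hcd : ∀ j : ℕ, 1 - z * c * d * q ^ j ≠ 0) (hbd : ∀ j : ℕ, 1 - z * b * d * q ^ j ≠ 0)
    (hbc : ∀ j : ℕ, 1 - z * b * c * q ^ j ≠ 0) :
    Tendsto (sixPhiAnti a b c d q z) atTop (𝓝 0) := by
  obtain ⟨C, hC, hCb⟩ := exists_norm_qPoch_le hq (‖a‖ + ‖b‖ + ‖c‖ + ‖d‖)
  obtain ⟨E, hE, hEb⟩ := exists_norm_inv_qPoch_le hq (one_sub_mul_pow_ne_zero hq hq)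
  obtain ⟨U, hU, hUb⟩ := exists_norm_inv_qPoch_le hq hcd
  obtain ⟨V, hV, hVb⟩ := exists_norm_inv_qPoch_le hq hbd
  obtain ⟨W, hW, hWb⟩ := exists_norm_inv_qPoch_le hq hbc
  have na := norm_nonneg a
  have nb := norm_nonneg b
  have nc := norm_nonneg c
  have nd := norm_nonneg d
  have hk : Tendsto (sixPhiKernel a b c d q z) atTop (𝓝 0) := by
    refine squeeze_zero_norm (a := fun n => C * C * C * C * ‖z‖ ^ n * (E * U * V * W))
      (fun n => ?_) ?_
    · rw [sixPhiKernel, div_eq_mul_inv, mul_inv, mul_inv, mul_inv]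
      simp only [norm_mul, norm_pow]
      gcongr
      · exact hCb _ (by linarith) _
      · exact hCb _ (by linarith) _
      · exact hCb _ (by linarith) _
      · exact hCb _ (by linarith) _
      · exact hEb _
      · exact hUb _
      · exact hVb _
      · exact hWb _
    · simpa using ((tendsto_pow_atTop_nhds_zero_of_lt_one (norm_nonneg _) hz).const_mul
        (C * C * C * C)).mul_const (E * U * V * W)
  have hx := tendsto_pow_atTop_nhds_zero_of_norm_lt_one hq
  have hc : Continuous fun x : ℂ => (1 - x) * (1 - z * c * d * x) * (1 - z * b * d * x) *
      (1 - z * b * c * x) * (-(1 - a * z * x) / ((1 - a) * (1 - z))) := by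
    fun_prop
  have := ((hc.tendsto 0).comp hx).mul hk
  rw [mul_zero] at this
  exact this

theorem exists_norm_sixPhiTerm_le {a b c d q z : ℂ} (hq : ‖q‖ < 1)
    (ha : ∀ j : ℕ, 1 - a * q ^ j ≠ 0)
    (hcd : ∀ j : ℕ, 1 - z * c * d * q ^ j ≠ 0) (hbd : ∀ j : ℕ, 1 - z * b * d * q ^ j ≠ 0)
    (hbc : ∀ j : ℕ, 1 - z * b * c * q ^ j ≠ 0) :
    ∃ K, ∀ m n : ℕ, ‖sixPhiTerm (a * q ^ m) b c d q (z * q ^ m) (n + 1)‖ ≤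
      K * (‖q‖ ^ m * ‖z‖ ^ (n + 1)) := by
  obtain ⟨C, hC, hCb⟩ := exists_norm_qPoch_le hq (‖a‖ + ‖b‖ + ‖c‖ + ‖d‖)
  obtain ⟨E, hE, hEb⟩ := exists_norm_inv_qPoch_le hq (one_sub_mul_pow_ne_zero hq hq)
  obtain ⟨U, hU, hUb⟩ := exists_norm_inv_qPoch_shift_le hq hcd
  obtain ⟨V, hV, hVb⟩ := exists_norm_inv_qPoch_shift_le hq hbd
  obtain ⟨W, hW, hWb⟩ := exists_norm_inv_qPoch_shift_le hq hbc
  obtain ⟨B, hB, hBb⟩ := exists_norm_inv_one_sub_le hq ha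
  have na := norm_nonneg a
  have nb := norm_nonneg b
  have nc := norm_nonneg c
  have nd := norm_nonneg d
  refine ⟨(1 + ‖a‖) * B * (C * C * C * C * (E * U * V * W)), fun m n => ?_⟩
  have e : sixPhiTerm (a * q ^ m) b c d q (z * q ^ m) (n + 1) =
      (1 - a * q ^ (m + 2 * (n + 1))) * (1 - a * q ^ m)⁻¹ *
      (qPoch (a * q ^ m) q (n + 1) * qPoch b q (n + 1) * qPoch c q (n + 1) *
        qPoch d q (n + 1) * ((qPoch q q (n + 1))⁻¹ * (qPoch (z * c * d * q ^ m) q (n + 1))⁻¹ *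
        (qPoch (z * b * d * q ^ m) q (n + 1))⁻¹ * (qPoch (z * b * c * q ^ m) q (n + 1))⁻¹)) *
      (z * q ^ m) ^ (n + 1) := by
    rw [sixPhiTerm, pow_add q m, show z * q ^ m * c * d = z * c * d * q ^ m by ring,
      show z * q ^ m * b * d = z * b * d * q ^ m by ring,
      show z * q ^ m * b * c = z * b * c * q ^ m by ring, div_eq_mul_inv, div_eq_mul_inv,
      mul_inv, mul_inv, mul_inv]
    ring
  have ham : ‖a * q ^ m‖ ≤ ‖a‖ + ‖b‖ + ‖c‖ + ‖d‖ := (norm_mul_pow_le hq m).trans (by linarith)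
  have hzm := norm_shift_pow_succ_le (z := z) hq m n
  rw [e, norm_mul _ ((z * q ^ m) ^ (n + 1))]
  refine mul_le_mul ?_ hzm (norm_nonneg _) (by positivity)
  simp only [norm_mul]
  gcongr
  · exact norm_one_sub_mul_pow_le hq _
  · exact hBb m
  · simpa using hCb _ ham _
  · exact hCb _ (by linarith) _
  · exact hCb _ (by linarith) _
  · exact hCb _ (by linarith) _
  · exact hEb _
  · exact hUb _ _
  · exact hVb _ _
  · exact hWb _ _

/-- The nonterminating `₆φ₅` summation, with the product as a limit of finite products. -/
theorem sixPhi_sum {a b c d q z : ℂ} (h : a * q = z * b * c * d) (hq : ‖q‖ < 1)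
    (hz : ‖z‖ < 1) (ha : ∀ j : ℕ, 1 - a * q ^ j ≠ 0)
    (hcd : ∀ j : ℕ, 1 - z * c * d * q ^ j ≠ 0) (hbd : ∀ j : ℕ, 1 - z * b * d * q ^ j ≠ 0)
    (hbc : ∀ j : ℕ, 1 - z * b * c * q ^ j ≠ 0) :
    ∃ S, HasSum (sixPhiTerm a b c d q z) S ∧
      Tendsto (fun N => ∏ m ∈ Finset.range N, sixPhiRatio (a * q ^ m) b c d q (z * q ^ m))
        atTop (𝓝 S) := by
  obtain ⟨K, hK⟩ := exists_norm_sixPhiTerm_le hq ha hcd hbd hbc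
  obtain ⟨hsum, hlim⟩ := tendsto_tsum_of_norm_le (norm_nonneg q) hq (norm_nonneg _) hz hK
  set T : ℕ → ℂ := fun m => ∑' n, sixPhiTerm (a * q ^ m) b c d q (z * q ^ m) n with hT
  have hs : ∀ m, Summable (sixPhiTerm (a * q ^ m) b c d q (z * q ^ m)) := fun m =>
    (summable_nat_add_iff 1).1 (hsum m)
  -- The term n = 0 is 1, and the tail n ≥ 1 tends to 0 by the uniform bound.
  have ht : Tendsto T atTop (𝓝 1) := by
    have := hlim.const_add (1 : ℂ)
    rw [add_zero] at this
    refine this.congr fun m => ?_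
    have hm : 1 - a * q ^ m ≠ 0 := ha m
    rw [hT]
    dsimp only
    rw [(hs m).tsum_eq_zero_add]
    simp [sixPhiTerm, qPoch_zero, hm]
  have hrec : ∀ m, T m = sixPhiRatio (a * q ^ m) b c d q (z * q ^ m) * T (m + 1) := by
    intro m
    have hzm : ‖z * q ^ m‖ < 1 := (norm_mul_pow_le hq m).trans_lt hz
    have hcd' : ∀ j : ℕ, 1 - z * q ^ m * c * d * q ^ j ≠ 0 := fun j => by
      convert one_sub_shift_ne_zero hcd m j using 1
      ring
    have hbd' : ∀ j : ℕ, 1 - z * q ^ m * b * d * q ^ j ≠ 0 := fun j => by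
      convert one_sub_shift_ne_zero hbd m j using 1
      ring
    have hbc' : ∀ j : ℕ, 1 - z * q ^ m * b * c * q ^ j ≠ 0 := fun j => by
      convert one_sub_shift_ne_zero hbc m j using 1
      ring
    have h' : a * q ^ m * q = z * q ^ m * b * c * d := by linear_combination q ^ m * h
    have e1 : a * q ^ m * q = a * q ^ (m + 1) := by ring
    have e2 : z * q ^ m * q = z * q ^ (m + 1) := by ring
    have h1 := ((hs m).hasSum.sub ((hs (m + 1)).hasSum.mul_left
      (sixPhiRatio (a * q ^ m) b c d q (z * q ^ m)))).tendsto_sum_nat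
    have h2 : Tendsto (fun n => sixPhiAnti (a * q ^ m) b c d q (z * q ^ m) n) atTop (𝓝 0) :=
      tendsto_sixPhiAnti hq hzm hcd' hbd' hbc'
    refine sub_eq_zero.1 (tendsto_nhds_unique h1 (h2.congr fun n => ?_))
    have h3 := Finset.sum_range_sub (sixPhiAnti (a * q ^ m) b c d q (z * q ^ m)) n
    rw [show sixPhiAnti (a * q ^ m) b c d q (z * q ^ m) 0 = 0 by simp [sixPhiAnti],
      sub_zero] at h3
    rw [← h3]
    refine Finset.sum_congr rfl fun k _ => ?_
    rw [← sixPhiTerm_telescope h' hq (one_sub_ne_zero_of_norm_lt_one hzm)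
      (one_sub_shift_ne_zero ha m) hcd' hbd' hbc', e1, e2]
  have hprod : ∀ N, T 0 =
      (∏ m ∈ Finset.range N, sixPhiRatio (a * q ^ m) b c d q (z * q ^ m)) * T N := by
    intro N
    induction N with
    | zero => simp
    | succ N ih => rw [Finset.prod_range_succ, mul_assoc, ← hrec, ← ih]
  refine ⟨T 0, by simpa [hT] using (hs 0).hasSum, ?_⟩
  -- The partial products equal T 0 / T N as soon as T N ≠ 0, so their convergence needs no separate
  -- argument.
  have hdiv : Tendsto (fun N => T 0 / T N) atTop (𝓝 (T 0 / 1)) :=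
    tendsto_const_nhds.div ht one_ne_zero
  rw [div_one] at hdiv
  refine hdiv.congr' ?_
  filter_upwards [ht.eventually_ne one_ne_zero] with N hN
  rw [div_eq_iff hN]
  exact hprod N

/-! ### The Lambert series of q ψ(q²) ψ(q⁶). -/

/-- Three factors for ψ(q²) go with one for ψ(q⁶), so that each step advances every exponent by 12,
the base of the `₆φ₅`. -/
theorem psiProd_mul_psiProd_succ {q : ℂ} (N : ℕ) :
    psiProd (q ^ 2) (3 * (N + 1)) * psiProd (q ^ 6) (N + 1) =
      psiProd (q ^ 2) (3 * N) * psiProd (q ^ 6) N *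
        ((1 - q ^ 4 * (q ^ 12) ^ N) * (1 - q ^ 8 * (q ^ 12) ^ N) * (1 - q ^ 12 * (q ^ 12) ^ N) ^ 2 /
          ((1 - q ^ 2 * (q ^ 12) ^ N) * (1 - q ^ 10 * (q ^ 12) ^ N) *
            (1 - q ^ 6 * (q ^ 12) ^ N) ^ 2)) := by
  rw [show 3 * (N + 1) = 3 * N + 1 + 1 + 1 by ring]
  simp only [psiProd_succ]
  rw [show (q ^ 2) ^ (2 * (3 * N) + 2) = q ^ 4 * (q ^ 12) ^ N by ring,
    show (q ^ 2) ^ (2 * (3 * N) + 1) = q ^ 2 * (q ^ 12) ^ N by ring,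
    show (q ^ 2) ^ (2 * (3 * N + 1) + 2) = q ^ 8 * (q ^ 12) ^ N by ring,
    show (q ^ 2) ^ (2 * (3 * N + 1) + 1) = q ^ 6 * (q ^ 12) ^ N by ring,
    show (q ^ 2) ^ (2 * (3 * N + 1 + 1) + 2) = q ^ 12 * (q ^ 12) ^ N by ring,
    show (q ^ 2) ^ (2 * (3 * N + 1 + 1) + 1) = q ^ 10 * (q ^ 12) ^ N by ring,
    show (q ^ 6) ^ (2 * N + 2) = q ^ 12 * (q ^ 12) ^ N by ring,
    show (q ^ 6) ^ (2 * N + 1) = q ^ 6 * (q ^ 12) ^ N by ring]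
  rw [pow_two (1 - q ^ 6 * (q ^ 12) ^ N)]
  simp only [div_eq_mul_inv, mul_inv]
  ring

/-- Five factors of the `₆φ₅` ratio (exponents 24, 16, 18, 22, 14) are those of the ψ-products (12,
4, 6, 10, 2) moved by one step q¹². The discrepancy therefore telescopes to boundary factors: a
constant at the lower end, and at the upper end an expression tending to 1. -/
theorem prod_sixPhiRatio_eq {q : ℂ} (hq : ‖q‖ < 1) (N : ℕ) :
    (∏ m ∈ Finset.range N, sixPhiRatio (q ^ 12 * (q ^ 12) ^ m) (q ^ 6) (q ^ 2) (q ^ 10) (q ^ 12)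
        (q ^ 6 * (q ^ 12) ^ m)) *
      ((1 - q ^ 12) * (1 - q ^ 4) / ((1 - q ^ 6) * (1 - q ^ 10) * (1 - q ^ 2))) =
    psiProd (q ^ 2) (3 * N) * psiProd (q ^ 6) N *
      ((1 - q ^ 12 * (q ^ 12) ^ N) * (1 - q ^ 4 * (q ^ 12) ^ N) /
        ((1 - q ^ 6 * (q ^ 12) ^ N) * (1 - q ^ 10 * (q ^ 12) ^ N) *
          (1 - q ^ 2 * (q ^ 12) ^ N))) := by
  induction N with
  | zero => simp [psiProd, qPoch_zero]
  | succ N ih =>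
    have hne : ∀ k : ℕ, k ≠ 0 → 1 - q ^ k * (q ^ 12) ^ N ≠ 0 := fun k hk =>
      one_sub_mul_pow_ne_zero (norm_pow_lt_one hq hk) (norm_pow_lt_one hq (by norm_num)) N
    have h2 := hne 2 (by norm_num)
    have h4 := hne 4 (by norm_num)
    have h6 := hne 6 (by norm_num)
    have h10 := hne 10 (by norm_num)
    have h12 := hne 12 (by norm_num)
    have h14 := hne 14 (by norm_num)
    have h18 := hne 18 (by norm_num)
    have h22 := hne 22 (by norm_num)
    rw [Finset.prod_range_succ, mul_right_comm, ih, psiProd_mul_psiProd_succ, sixPhiRatio]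
    generalize psiProd (q ^ 2) (3 * N) * psiProd (q ^ 6) N = T
    rw [show q ^ 12 * (q ^ 12) ^ N * q ^ 12 = q ^ 24 * (q ^ 12) ^ N by ring,
      show q ^ 6 * (q ^ 12) ^ N * q ^ 6 = q ^ 12 * (q ^ 12) ^ N by ring,
      show q ^ 6 * (q ^ 12) ^ N * q ^ 2 = q ^ 8 * (q ^ 12) ^ N by ring,
      show q ^ 6 * (q ^ 12) ^ N * q ^ 10 = q ^ 16 * (q ^ 12) ^ N by ring,
      show q ^ 8 * (q ^ 12) ^ N * q ^ 10 = q ^ 18 * (q ^ 12) ^ N by ring,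
      show q ^ 12 * (q ^ 12) ^ N * q ^ 10 = q ^ 22 * (q ^ 12) ^ N by ring,
      show q ^ 12 * (q ^ 12) ^ N * q ^ 2 = q ^ 14 * (q ^ 12) ^ N by ring,
      show q ^ 12 * (q ^ 12) ^ (N + 1) = q ^ 24 * (q ^ 12) ^ N by ring,
      show q ^ 4 * (q ^ 12) ^ (N + 1) = q ^ 16 * (q ^ 12) ^ N by ring,
      show q ^ 6 * (q ^ 12) ^ (N + 1) = q ^ 18 * (q ^ 12) ^ N by ring,
      show q ^ 10 * (q ^ 12) ^ (N + 1) = q ^ 22 * (q ^ 12) ^ N by ring,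
      show q ^ 2 * (q ^ 12) ^ (N + 1) = q ^ 14 * (q ^ 12) ^ N by ring]
    generalize 1 - q ^ 2 * (q ^ 12) ^ N = x2 at h2 ⊢
    generalize 1 - q ^ 4 * (q ^ 12) ^ N = x4 at h4 ⊢
    generalize 1 - q ^ 6 * (q ^ 12) ^ N = x6 at h6 ⊢
    generalize 1 - q ^ 8 * (q ^ 12) ^ N = x8
    generalize 1 - q ^ 10 * (q ^ 12) ^ N = x10 at h10 ⊢
    generalize 1 - q ^ 12 * (q ^ 12) ^ N = x12 at h12 ⊢
    generalize 1 - q ^ 14 * (q ^ 12) ^ N = x14 at h14 ⊢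
    generalize 1 - q ^ 16 * (q ^ 12) ^ N = x16
    generalize 1 - q ^ 18 * (q ^ 12) ^ N = x18 at h18 ⊢
    generalize 1 - q ^ 22 * (q ^ 12) ^ N = x22 at h22 ⊢
    generalize 1 - q ^ 24 * (q ^ 12) ^ N = x24
    field_simp

/-- The Lambert series of `q ψ(q²) ψ(q⁶)`, as a limit of partial sums. -/
theorem tendsto_lambert_psi_mul_psi {q : ℂ} (hq : ‖q‖ < 1) :
    Tendsto (fun N => ∑ m ∈ Finset.range N, (q * q ^ (6 * m) / (1 - (q * q ^ (6 * m)) ^ 2) -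
        q ^ 5 * q ^ (6 * m) / (1 - (q ^ 5 * q ^ (6 * m)) ^ 2))) atTop
      (𝓝 (q * (ramanujanPsi (q ^ 2) * ramanujanPsi (q ^ 6)))) := by
  have hn : ∀ k : ℕ, k ≠ 0 → ‖q ^ k‖ < 1 := fun k hk => norm_pow_lt_one hq hk
  have hp : ‖q ^ 12‖ < 1 := hn 12 (by norm_num)
  have hne : ∀ k : ℕ, k ≠ 0 → ∀ j : ℕ, 1 - q ^ k * (q ^ 12) ^ j ≠ 0 := fun k hk =>
    one_sub_mul_pow_ne_zero (hn k hk) hp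
  have hne1 : ∀ k : ℕ, k ≠ 0 → 1 - q ^ k ≠ 0 := fun k hk =>
    one_sub_ne_zero_of_norm_lt_one (hn k hk)
  -- With these parameters (a)_m cancels (q¹²; q¹²)_m, and the denominator parameters q¹⁸, q²², q¹⁴
  -- are q⁶, q¹⁰, q² times the base. Each remaining quotient of factorials then collapses to a
  -- single factor.
  obtain ⟨S, hS, hSp⟩ := sixPhi_sum (a := q ^ 12) (b := q ^ 6) (c := q ^ 2) (d := q ^ 10)
    (q := q ^ 12) (z := q ^ 6) (by ring) hp (hn 6 (by norm_num)) (hne 12 (by norm_num))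
    (by simpa only [← pow_add] using hne 18 (by norm_num))
    (by simpa only [← pow_add] using hne 22 (by norm_num))
    (by simpa only [← pow_add] using hne 14 (by norm_num))
  set k : ℂ := (1 - q ^ 12) * (1 - q ^ 4) / ((1 - q ^ 6) * (1 - q ^ 10) * (1 - q ^ 2)) with hk
  have hval : S * k = ramanujanPsi (q ^ 2) * ramanujanPsi (q ^ 6) := by
    refine tendsto_nhds_unique (hSp.mul_const k) ?_
    have h3 := (tendsto_psiProd (hn 2 (by norm_num))).comp
      (tendsto_id.const_mul_atTop' (by norm_num : 0 < 3))
    have hx := tendsto_pow_atTop_nhds_zero_of_norm_lt_one hp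
    have hc : ContinuousAt (fun x : ℂ => (1 - q ^ 12 * x) * (1 - q ^ 4 * x) /
        ((1 - q ^ 6 * x) * (1 - q ^ 10 * x) * (1 - q ^ 2 * x))) 0 := by
      refine ContinuousAt.div ?_ ?_ ?_ <;> first | fun_prop | simp
    have := (h3.mul (tendsto_psiProd (hn 6 (by norm_num)))).mul (hc.tendsto.comp hx)
    simp only [mul_zero, sub_zero, mul_one, div_one] at this
    exact this.congr fun N => (prod_sixPhiRatio_eq hq N).symm
  have := (hS.tendsto_sum_nat.mul_const k).const_mul q
  rw [hval] at this
  refine this.congr fun N => ?_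
  rw [Finset.sum_mul, Finset.mul_sum]
  refine Finset.sum_congr rfl fun m _ => ?_
  have hs : ∀ x : ℂ, 1 - x ≠ 0 → qPoch (x * q ^ 12) (q ^ 12) m =
      qPoch x (q ^ 12) m * (1 - x * (q ^ 12) ^ m) / (1 - x) := fun x hx => by
    rw [eq_div_iff hx, mul_comm, one_sub_mul_qPoch_shift]
  have g2 := hne1 2 (by norm_num)
  have g6 := hne1 6 (by norm_num)
  have g10 := hne1 10 (by norm_num)
  have g12 := hne1 12 (by norm_num)
  have h2 := hne 2 (by norm_num) m
  have h6 := hne 6 (by norm_num) m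
  have h10 := hne 10 (by norm_num) m
  have p2 := qPoch_ne_zero (hne 2 (by norm_num)) m
  have p6 := qPoch_ne_zero (hne 6 (by norm_num)) m
  have p10 := qPoch_ne_zero (hne 10 (by norm_num)) m
  have p12 := qPoch_ne_zero (hne 12 (by norm_num)) m
  rw [sixPhiTerm, show q ^ 6 * q ^ 2 * q ^ 10 = q ^ 6 * q ^ 12 by ring,
    show q ^ 6 * q ^ 6 * q ^ 10 = q ^ 10 * q ^ 12 by ring,
    show q ^ 6 * q ^ 6 * q ^ 2 = q ^ 2 * q ^ 12 by ring, hs _ g6, hs _ g10, hs _ g2, hk,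
    show 1 - q ^ 12 * (q ^ 12) ^ (2 * m) =
      (1 - q ^ 6 * (q ^ 12) ^ m) * (1 + q ^ 6 * (q ^ 12) ^ m) by ring,
    show (q * q ^ (6 * m)) ^ 2 = q ^ 2 * (q ^ 12) ^ m by ring,
    show (q ^ 5 * q ^ (6 * m)) ^ 2 = q ^ 10 * (q ^ 12) ^ m by ring, ← pow_mul q 6 m]
  -- Partial fractions: the very-well-poised factor 1 + q^(12m+6) is what splits the `₆φ₅` term into
  -- the two Lambert terms.
  have e : q ^ (6 * m) * (q * (1 - q ^ 4) * (1 + q ^ 6 * (q ^ 12) ^ m)) =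
      q ^ (6 * m) * (q * (1 - q ^ 10 * (q ^ 12) ^ m) - q ^ 5 * (1 - q ^ 2 * (q ^ 12) ^ m)) := by
    ring
  have e' : q * q ^ (6 * m) / (1 - q ^ 2 * (q ^ 12) ^ m) -
      q ^ 5 * q ^ (6 * m) / (1 - q ^ 10 * (q ^ 12) ^ m) =
      q ^ (6 * m) * (q * (1 - q ^ 4) * (1 + q ^ 6 * (q ^ 12) ^ m)) /
        ((1 - q ^ 2 * (q ^ 12) ^ m) * (1 - q ^ 10 * (q ^ 12) ^ m)) := by
    rw [e, div_sub_div _ _ h2 h10]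
    ring
  rw [e']
  generalize qPoch (q ^ 2) (q ^ 12) m = P2 at p2 ⊢
  generalize qPoch (q ^ 6) (q ^ 12) m = P6 at p6 ⊢
  generalize qPoch (q ^ 10) (q ^ 12) m = P10 at p10 ⊢
  generalize qPoch (q ^ 12) (q ^ 12) m = P12 at p12 ⊢
  generalize 1 - q ^ 2 * (q ^ 12) ^ m = x2 at h2 ⊢
  generalize 1 - q ^ 6 * (q ^ 12) ^ m = x6 at h6 ⊢
  generalize 1 - q ^ 10 * (q ^ 12) ^ m = x10 at h10 ⊢
  generalize 1 + q ^ 6 * (q ^ 12) ^ m = y6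
  generalize q ^ (6 * m) = Z
  generalize 1 - q ^ 2 = y2 at g2 ⊢
  generalize 1 - q ^ 6 = y6' at g6 ⊢
  generalize 1 - q ^ 10 = y10 at g10 ⊢
  generalize 1 - q ^ 12 = y12 at g12 ⊢
  generalize 1 - q ^ 4 = y4
  field_simp

/-! ### Odd parts and specialisation to 1/q and 1/q⁵. -/

/-- The parameters 1/q and 1/q⁵ lie outside the unit disc, so smallness is not available. Instead |β
q^(6j)| = |q|^(r+6j) has a nonzero exponent and hence is never 1. -/
theorem one_sub_mul_pow_ne_zero_of_norm_zpow {q β : ℂ} {r : ℤ} (hq0 : q ≠ 0) (hq : ‖q‖ < 1)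
    (hβ : ‖β‖ = ‖q‖ ^ r) (hr : ∀ j : ℕ, r + 6 * j ≠ 0) (j : ℕ) : 1 - β * (q ^ 6) ^ j ≠ 0 := by
  intro h
  have h1 : ‖β * (q ^ 6) ^ j‖ = 1 := by rw [← sub_eq_zero.1 h, norm_one]
  have hpos : 0 < ‖q‖ := norm_pos_iff.2 hq0
  rw [norm_mul, ← pow_mul, norm_pow, hβ, ← zpow_natCast, ← zpow_add₀ hpos.ne',
    zpow_eq_one_iff_right₀ hpos.le hq.ne] at h1
  exact hr j (by push_cast at h1; exact h1)

theorem hasSum_pnat_of_succ {f : ℕ → ℂ} {S : ℂ} (h : HasSum (fun n => f (n + 1)) S) :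
    HasSum (fun n : ℕ+ => f n) S := by
  simpa [Function.comp_def] using (Equiv.pnatEquivNat.hasSum_iff (f := fun n => f (n + 1))).2 h

/-- The odd part in `β` of the very-well-poised series in base `q⁶`. -/
theorem exists_hasSum_vwpTerm_odd {q β : ℂ} {r : ℤ} (hq0 : q ≠ 0) (hq : ‖q‖ < 1)
    (hβ : ‖β‖ = ‖q‖ ^ r) (hr6 : -6 < r) (hr : ∀ j : ℕ, r + 6 * j ≠ 0)
    (hr2 : ∀ j : ℕ, 6 + 2 * r + 6 * j ≠ 0) :
    ∃ S T, HasSum (fun n : ℕ+ => vwpTerm β (q ^ 6) n) S ∧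
      HasSum (fun n : ℕ+ => vwpTerm (-β) (q ^ 6) n) T ∧
      Tendsto (fun N => ∑ m ∈ Finset.range N,
        2 * (β * q ^ 6 * q ^ (6 * m) / (1 - (β * q ^ 6 * q ^ (6 * m)) ^ 2)))
        atTop (𝓝 (S - T)) := by
  have hpos : 0 < ‖q‖ := norm_pos_iff.2 hq0
  have hQ : ‖q ^ 6‖ < 1 := norm_pow_lt_one hq (by norm_num)
  have hβQ : ‖β * q ^ 6‖ < 1 := by
    rw [norm_mul, norm_pow, hβ, ← zpow_natCast, ← zpow_add₀ hpos.ne']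
    exact zpow_lt_one₀ hpos hq (by push_cast; omega)
  have hβ' : ‖-β‖ = ‖q‖ ^ r := by rw [norm_neg, hβ]
  have hsq : ‖q ^ 6 * β ^ 2‖ = ‖q‖ ^ (6 + 2 * r) := by
    rw [norm_mul, norm_pow, norm_pow, hβ, zpow_add₀ hpos.ne', mul_comm 2 r, zpow_mul]
    norm_cast
  have h1 := one_sub_mul_pow_ne_zero_of_norm_zpow hq0 hq hβ hr
  have h1' := one_sub_mul_pow_ne_zero_of_norm_zpow hq0 hq hβ' hr
  have h2 := one_sub_mul_pow_ne_zero_of_norm_zpow hq0 hq hsq hr2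
  obtain ⟨S, hS, hSl⟩ := tendsto_sum_vwpDiff hQ hβQ h1 h2
  obtain ⟨T, hT, hTl⟩ := tendsto_sum_vwpDiff hQ (by rwa [neg_mul, norm_neg]) h1'
    (by rwa [neg_sq])
  refine ⟨S, T, hasSum_pnat_of_succ hS, hasSum_pnat_of_succ hT, ?_⟩
  refine (hSl.sub hTl).congr fun N => ?_
  rw [← Finset.sum_sub_distrib]
  refine Finset.sum_congr rfl fun m _ => ?_
  have hm : 1 - β * (q ^ 6) ^ m * q ^ 6 ≠ 0 := by
    convert h1 (m + 1) using 1
    ring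
  have hm' : 1 + β * (q ^ 6) ^ m * q ^ 6 ≠ 0 := by
    convert h1' (m + 1) using 1
    ring
  rw [show β * q ^ 6 * q ^ (6 * m) = β * (q ^ 6) ^ m * q ^ 6 by ring, vwpDiff, vwpDiff, neg_mul,
    neg_sq, neg_mul, sub_neg_eq_add, ← pow_mul q 6 m] at *
  generalize β * q ^ (6 * m) = x at *
  rw [show 1 - (x * q ^ 6) ^ 2 = (1 - x * q ^ 6) * (1 + x * q ^ 6) by ring, neg_div]
  -- These two parts of `vwpDiff` are even in β and cancel in the difference.
  generalize x ^ 2 * q ^ 6 / (1 - x ^ 2 * q ^ 6) = A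
  generalize x ^ 2 * (q ^ 6) ^ 2 / (1 - x ^ 2 * (q ^ 6) ^ 2) = B
  generalize x * q ^ 6 = y at hm hm' ⊢
  field_simp
  ring

theorem corollary6 (q : ℂ) (hq0 : q ≠ 0) (hq1 : ‖q‖ < 1) :
    ∃ S₁ S₂ S₃ S₄ : ℂ,
      HasSum (fun n : ℕ+ =>
        (1 + q ^ (12 * (n : ℕ) - 1)) / (1 + 1 / q) *
          (qPoch (-1 / q) (q ^ 6) n * qPoch (-1 / q) (q ^ 6) n *
              qPoch (q ^ 6) (q ^ 6) (2 * (n : ℕ) - 1) * (-q) ^ (5 * (n : ℕ)) /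
            (qPoch (q ^ 6) (q ^ 6) n * qPoch (q ^ 6) (q ^ 6) n *
              qPoch (q ^ 4) (q ^ 6) (2 * (n : ℕ))))) S₁ ∧
      HasSum (fun n : ℕ+ =>
        (1 - q ^ (12 * (n : ℕ) - 1)) / (1 - 1 / q) *
          (qPoch (1 / q) (q ^ 6) n * qPoch (1 / q) (q ^ 6) n *
              qPoch (q ^ 6) (q ^ 6) (2 * (n : ℕ) - 1) * q ^ (5 * (n : ℕ)) /
            (qPoch (q ^ 6) (q ^ 6) n * qPoch (q ^ 6) (q ^ 6) n *
              qPoch (q ^ 4) (q ^ 6) (2 * (n : ℕ))))) S₂ ∧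
      HasSum (fun n : ℕ+ =>
        (1 - q ^ (12 * (n : ℕ) - 5)) / (1 - 1 / q ^ 5) *
          (qPoch (1 / q ^ 5) (q ^ 6) n * qPoch (1 / q ^ 5) (q ^ 6) n *
              qPoch (q ^ 6) (q ^ 6) (2 * (n : ℕ) - 1) * q ^ (n : ℕ) /
            (qPoch (q ^ 6) (q ^ 6) n * qPoch (q ^ 6) (q ^ 6) n *
              qPoch (1 / q ^ 4) (q ^ 6) (2 * (n : ℕ))))) S₃ ∧
      HasSum (fun n : ℕ+ =>
        (1 + q ^ (12 * (n : ℕ) - 5)) / (1 + 1 / q ^ 5) *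
          (qPoch (-1 / q ^ 5) (q ^ 6) n * qPoch (-1 / q ^ 5) (q ^ 6) n *
              qPoch (q ^ 6) (q ^ 6) (2 * (n : ℕ) - 1) * (-q) ^ (n : ℕ) /
            (qPoch (q ^ 6) (q ^ 6) n * qPoch (q ^ 6) (q ^ 6) n *
              qPoch (1 / q ^ 4) (q ^ 6) (2 * (n : ℕ))))) S₄ ∧
      2 * q * ramanujanPsi (q ^ 2) * ramanujanPsi (q ^ 6) = S₁ - S₂ + S₃ - S₄ := by
  -- The positive sign of β gives S₂ here but S₃ below, so this odd part is the one to be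
  -- subtracted.
  obtain ⟨S₂, S₁, h₂, h₁, hlim₁⟩ := exists_hasSum_vwpTerm_odd (β := 1 / q) (r := -1) hq0 hq1
    (by simp) (by norm_num) (by omega) (by omega)
  obtain ⟨S₃, S₄, h₃, h₄, hlim₂⟩ := exists_hasSum_vwpTerm_odd (β := 1 / q ^ 5) (r := -5) hq0 hq1
    (by rw [zpow_neg]; simp) (by norm_num) (by omega) (by omega)
  -- The natural subtraction 12n - k is exact because n ≥ 1 and k ≤ 12.
  have hpow : ∀ (k : ℕ) (n : ℕ+), k ≤ 12 →
      1 / q ^ k * (q ^ 6) ^ (2 * (n : ℕ)) = q ^ (12 * (n : ℕ) - k) := by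
    intro k n hk
    have hn := n.pos
    rw [one_div_mul_eq_div, ← pow_mul, div_eq_iff (pow_ne_zero _ hq0), ← pow_add]
    congr 1
    omega
  have hpow1 : ∀ n : ℕ+, 1 / q * (q ^ 6) ^ (2 * (n : ℕ)) = q ^ (12 * (n : ℕ) - 1) := fun n => by
    simpa using hpow 1 n (by norm_num)
  have e1 : 1 / q * q ^ 6 = q ^ 5 := by field_simp
  have e2 : q ^ 6 * (1 / q) ^ 2 = q ^ 4 := by field_simp
  have e3 : 1 / q ^ 5 * q ^ 6 = q := by field_simp
  have e4 : q ^ 6 * (1 / q ^ 5) ^ 2 = 1 / q ^ 4 := by field_simp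
  refine ⟨S₁, S₂, S₃, S₄, ?_, ?_, ?_, ?_, ?_⟩
  · convert h₁ using 2 with n
    rw [vwpTerm, neg_mul, sub_neg_eq_add, sub_neg_eq_add, hpow1, neg_mul, neg_sq, e1, e2,
      neg_div, pow_mul, Odd.neg_pow (by decide : Odd 5)]
  · convert h₂ using 2 with n
    rw [vwpTerm, hpow1, e1, e2, pow_mul q 5]
  · convert h₃ using 2 with n
    rw [vwpTerm, hpow 5 n (by norm_num), e3, e4]
  · convert h₄ using 2 with n
    rw [vwpTerm, neg_mul, sub_neg_eq_add, sub_neg_eq_add, hpow 5 n (by norm_num), neg_mul, neg_sq,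
      e3, e4, neg_div]
  -- Twice the Lambert series is the odd part at 1/q⁵ minus the odd part at 1/q, that is (S₃ - S₄) -
  -- (S₂ - S₁).
  · have hψ := (tendsto_lambert_psi_mul_psi hq1).const_mul 2
    rw [e1] at hlim₁
    rw [e3] at hlim₂
    have := tendsto_nhds_unique hψ ((hlim₂.sub hlim₁).congr fun N => by
      rw [← Finset.sum_sub_distrib, Finset.mul_sum]
      exact Finset.sum_congr rfl fun m _ => (mul_sub _ _ _).symm)
    linear_combination this
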